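/- For complex $u$ with $\operatorname{Re} u>0$ let $\Phi(z,s,u)$ denote the Lerch transcendent, i.e. the analytic continuation of the series $\sum_{n\ge 0} z^n (u+n)^{-s}$ (principal branch of the power): for $z\in\mathbb C\setminus[1,\infty)$ and any complex $s$ it is continued in $z$ from the unit disc, and for $z=1$ it is continued in $s$ from $\operatorname{Re} s>1$ to $\mathbb C\setminus\{1\}$. **Theorem.** Let $m>1$ be an integer and $u$ a complex number with $\operatorname{Re} u>0$, and suppose that either $z\in\mathbb C\setminus[1,\infty)$ and $\operatorname{Re} s>-m-1$, or $z=1$ and $\operatorname{Re} s>-m$. Then the integral on the left below converges absolutely, and $$\int_{[0,1]^m} \frac{m-1-x_1-x_1x_2-\cdots-x_1x_2\cdots x_{m-1}}{1-z\,x_1x_2\cdots x_m}\,(x_1x_2\cdots x_m)^{u-1}\,(-\ln x_1x_2\cdots x_m)^{s}\,dx_1\cdots dx_m$$ $$=\frac{\Gamma(s+m)}{(m-2)!}\left[\Phi(z,s+m,u)+\frac{(1-z)\,\Phi(z,s+m-1,u)-u^{-s-m+1}}{z\,(s+m-1)}\right].$$ Here, for $z=1$, the term $(1-z)\Phi(z,s+m-1,u)$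 is read as $0$. Where the right-hand side is not defined as written, it is read as its limit: if $z\in\mathbb C\setminus[1,\infty)$ and $z=0$, $s=1-m$ or $s=-m$, this is the limit as $(z',s')\to(z,s)$ through points with $z'\ne 0$, $s'\ne 1-m$, $s'\ne -m$; if $z=1$ and $s=1-m$, it is the limit as $s'\to 1-m$, $s'\neq 1-m$, with $z=1$ fixed. -/

import Mathlib

open Filter Topology MeasureTheory

noncomputable section

/-- The series `∑ zⁿ / (u + n)ˢ`, with the principal branch of the power. -/
def lerchSeries (z s u : ℂ) : ℂ :=
  ∑' n : ℕ, z ^ n / (u + (n : ℂ)) ^ s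

/-- The cut plane `ℂ ∖ [1, ∞)`. -/
def cutPlane : Set ℂ := (Complex.ofReal '' Set.Ici (1 : ℝ))ᶜ

/-- The half-plane `Re w > c` without the point `1`. -/
def puncturedHalfPlane (c : ℝ) : Set ℂ := {w | c < w.re ∧ w ≠ 1}

/-- `g` is analytic on `U` and agrees with `f` on the part of `V` in `U`. -/
def IsAnalyticContinuation (f : ℂ → ℂ) (V U : Set ℂ) (g : ℂ → ℂ) : Prop :=
  AnalyticOnNhd ℂ g U ∧ Set.EqOn g f (V ∩ U)

/-- `v` is the value at `p` of an analytic continuation of `f` from `V` to a member, containing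
`p`, of the family `𝒰` of domains. It is used below for families that consist of connected open
sets, any two of which meet in a connected set that meets `V` in a non-empty open set, so that
there is at most one such value. -/
def IsContinuationValue (f : ℂ → ℂ) (V : Set ℂ) (𝒰 : Set (Set ℂ)) (p v : ℂ) : Prop :=
  ∃ U ∈ 𝒰, p ∈ U ∧ ∃ g : ℂ → ℂ, IsAnalyticContinuation f V U g ∧ g p = v

open Classical in
/-- The value at `p` of the analytic continuation of `f` (and `0` where there is none). -/
def continuationValue (f : ℂ → ℂ) (V : Set ℂ) (𝒰 : Set (Set ℂ)) (p : ℂ) : ℂ :=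
  if h : ∃ v, IsContinuationValue f V 𝒰 p v then h.choose else 0

/-- The Lerch transcendent `Φ(z, s, u)`, for `Re u > 0`. For `z ∈ ℂ ∖ [1, ∞)` it is the analytic
continuation in `z` of the series from the unit disc to the cut plane; for `z = 1` and `s ≠ 1`
it is the analytic continuation in `s` of the series from the half-plane `Re s > 1`
to `ℂ ∖ {1}`, the union of the punctured half-planes. -/
def lerchPhi (z s u : ℂ) : ℂ :=
  if z = 1 then
    continuationValue (fun w => lerchSeries 1 w u) {w | 1 < w.re}
      (Set.range puncturedHalfPlane) s
  else
    continuationValue (fun w => lerchSeries w s u) (Metric.ball 0 1) {cutPlane} z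

/-- `x₁ x₂ ⋯ x_k`. -/
def partialProd {m : ℕ} (x : Fin m → ℝ) (k : ℕ) : ℝ :=
  ∏ j ∈ Finset.univ.filter (fun j : Fin m => j.val < k), x j

/-- The integrand
`(m-1-x₁-x₁x₂-⋯-x₁⋯x_{m-1}) (x₁⋯x_m)^{u-1} (-ln x₁⋯x_m)^s / (1 - z x₁⋯x_m)`. -/
def cubeIntegrand (m : ℕ) (z s u : ℂ) (x : Fin m → ℝ) : ℂ :=
  ((m : ℂ) - 1 - ∑ k ∈ Finset.Icc 1 (m - 1), (partialProd x k : ℂ))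
    / (1 - z * ((∏ j, x j : ℝ) : ℂ))
    * ((∏ j, x j : ℝ) : ℂ) ^ (u - 1)
    * ((-Real.log (∏ j, x j) : ℝ) : ℂ) ^ s

/-- The right-hand side
`Γ(s+m)/(m-2)! [Φ(z,s+m,u) + ((1-z) Φ(z,s+m-1,u) - u^{-s-m+1}) / (z (s+m-1))]`. -/
def closedForm (m : ℕ) (z s u : ℂ) : ℂ :=
  Complex.Gamma (s + m) / ((m - 2).factorial : ℂ)
    * (lerchPhi z (s + m) u
      + ((1 - z) * lerchPhi z (s + m - 1) u - u ^ (-s - m + 1)) / (z * (s + m - 1)))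

end

noncomputable section

open scoped ENNReal

/-! ### The weighted law of `-log (x₁ ⋯ x_m)` on the cube -/

/-! The integrand is the weight `m - 1 - x₁ - ⋯ - x₁⋯x_{m-1}` times a function of `t = -log
(x₁⋯x_m)` alone, so only the weighted law of `t` matters. Under Lebesgue measure the `-log xᵢ` are
independent exponentials. An induction on the number of coordinates
(`lintegral_openCube_deficitWeight`) gives the weighted law the density `e⁻ᵗ t^{m-1} r(t) / (m-2)!`,
where `r(t) = 1 - (1 - e⁻ᵗ)/t`. With `σ = s + m` the cube integral is therefore `1/(m-2)!` times
`∫₀^∞ t^{σ-1} e^{-ut} r(t) / (1 - z e⁻ᵗ) dt`, which is `deficitIntegral`. Since `r(t) ≤ t`, it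
converges for `Re σ > -1` off the cut; at `z = 1` the pole of `1/(1 - e⁻ᵗ)` uses up this zero and
`Re σ > 0` is needed.

For `|z| < 1`, expand geometrically. The term with `v = u + n` is `Γ(σ) v^{-σ} - Γ(σ-1) (v^{1-σ} -
(v+1)^{1-σ})` (`mellin_exp_mul_deficitRatio`, with denominators cleared). Summed against `zⁿ`, the
first part gives `Φ(z,σ,u)`; the difference gives `Φ(z,σ-1,u)` minus its shift `(Φ(z,σ-1,u) -
u^{1-σ})/z`. The identity theorem carries this to the cut plane (`deficitIntegral_eq`).

At `z = 1`, writing `1 = r(t) + (1 - e⁻ᵗ)/t` in the numerator gives `Γ(σ) Φ(1,σ,u) = deficitIntegral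
+ Γ(σ-1) u^{1-σ}` for `Re σ > 1`; its right-hand side, divided by `Γ(σ)`, continues `Φ` to `Re σ >
0`, `σ ≠ 1` (`lerchPhi_one`). The limits at removable singularities follow because `deficitIntegral`
is itself continuous there. -/

/-- The open unit cube. -/
def openCube (n : ℕ) : Set (Fin n → ℝ) := Set.pi Set.univ fun _ => Set.Ioo 0 1

theorem measurableSet_openCube (n : ℕ) : MeasurableSet (openCube n) :=
  MeasurableSet.univ_pi fun _ => measurableSet_Ioo

theorem lintegral_Ioo_eq_lintegral_exp_neg (G : ℝ → ℝ≥0∞) :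
    ∫⁻ y in Set.Ioo (0 : ℝ) 1, G y
      = ∫⁻ r in Set.Ioi (0 : ℝ), ENNReal.ofReal (Real.exp (-r)) * G (Real.exp (-r)) := by
  have himg : (fun r : ℝ => Real.exp (-r)) '' Set.Ioi 0 = Set.Ioo 0 1 := by
    ext y
    simp only [Set.mem_image, Set.mem_Ioi, Set.mem_Ioo]
    constructor
    · rintro ⟨r, hr, rfl⟩
      exact ⟨Real.exp_pos _, Real.exp_lt_one_iff.2 (by linarith)⟩
    · rintro ⟨h0, h1⟩
      exact ⟨-Real.log y, by linarith [Real.log_neg h0 h1], by simp [Real.exp_log h0]⟩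
  have hd : ∀ x ∈ Set.Ioi (0 : ℝ),
      HasDerivWithinAt (fun r : ℝ => Real.exp (-r)) (-Real.exp (-x)) (Set.Ioi 0) x := by
    intro x _
    have := ((hasDerivAt_neg x).exp).hasDerivWithinAt (s := Set.Ioi 0)
    simpa using this
  have hinj : Set.InjOn (fun r : ℝ => Real.exp (-r)) (Set.Ioi 0) := by
    intro a _ b _ h
    simpa using h
  rw [← himg, lintegral_image_eq_lintegral_abs_deriv_mul measurableSet_Ioi hd hinj]
  simp [abs_neg, Real.abs_exp]

theorem lintegral_Ioi_translate (g : ℝ → ℝ≥0∞) {t : ℝ} (ht : 0 < t) :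
    ∫⁻ r in Set.Ioi (0 : ℝ), g (t + r)
      = ∫⁻ τ in Set.Ioi (0 : ℝ), (Set.Ioi t).indicator g τ := by
  rw [← lintegral_indicator measurableSet_Ioi, setLIntegral_indicator measurableSet_Ioi,
    Set.inter_eq_left.2 (Set.Ioi_subset_Ioi ht.le), ← lintegral_indicator measurableSet_Ioi,
    ← lintegral_add_left_eq_self ((Set.Ioi t).indicator g) t]
  congr 1
  ext r
  simp [Set.indicator]

/-- If `T` has density `e⁻ᵗ w(t)` on the half-line and `Y` is uniform on `(0, 1)`, then
`T - log Y` has density `e⁻ᵗ ∫₀ᵗ w`. -/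
theorem lintegral_sub_log_eq {w F : ℝ → ℝ≥0∞} (hw : Measurable w) (hF : Measurable F) :
    ∫⁻ y in Set.Ioo (0 : ℝ) 1, ∫⁻ t in Set.Ioi (0 : ℝ),
        ENNReal.ofReal (Real.exp (-t)) * w t * F (t - Real.log y)
      = ∫⁻ τ in Set.Ioi (0 : ℝ),
          ENNReal.ofReal (Real.exp (-τ)) * (∫⁻ t in Set.Ioo 0 τ, w t) * F τ := by
  rw [lintegral_Ioo_eq_lintegral_exp_neg]
  -- With `y = e⁻ʳ` the two exponential factors merge into `e^{-(t+r)}`, so they depend only on `τ =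
  -- t + r`.
  let g : ℝ → ℝ≥0∞ := fun τ => ENNReal.ofReal (Real.exp (-τ)) * F τ
  have hg : Measurable g := by fun_prop
  calc
    _ = ∫⁻ r in Set.Ioi (0 : ℝ), ∫⁻ t in Set.Ioi (0 : ℝ), w t * g (t + r) := by
      refine lintegral_congr fun r => ?_
      rw [← lintegral_const_mul _ (by fun_prop)]
      refine lintegral_congr fun t => ?_
      simp only [g, Real.log_exp, sub_neg_eq_add, neg_add, Real.exp_add]
      rw [ENNReal.ofReal_mul (Real.exp_pos _).le]
      ring
    _ = ∫⁻ t in Set.Ioi (0 : ℝ), ∫⁻ r in Set.Ioi (0 : ℝ), w t * g (t + r) :=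
      lintegral_lintegral_swap (by fun_prop)
    _ = ∫⁻ t in Set.Ioi (0 : ℝ), ∫⁻ τ in Set.Ioi (0 : ℝ), w t * (Set.Ioi t).indicator g τ := by
      refine setLIntegral_congr_fun measurableSet_Ioi fun t ht => ?_
      rw [lintegral_const_mul _ (by fun_prop), lintegral_Ioi_translate g ht,
        lintegral_const_mul _ (hg.indicator measurableSet_Ioi)]
    _ = ∫⁻ τ in Set.Ioi (0 : ℝ), ∫⁻ t in Set.Ioi (0 : ℝ), w t * (Set.Ioi t).indicator g τ := by
      refine lintegral_lintegral_swap (Measurable.aemeasurable ?_)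
      have : (Function.uncurry fun t τ : ℝ => w t * (Set.Ioi t).indicator g τ)
          = fun p : ℝ × ℝ => w p.1 * {p : ℝ × ℝ | p.1 < p.2}.indicator (fun p => g p.2) p := by
        ext p; simp [Function.uncurry, Set.indicator]
      rw [this]
      exact (by fun_prop : Measurable fun p : ℝ × ℝ => w p.1).mul
        ((by fun_prop : Measurable fun p : ℝ × ℝ => g p.2).indicator
          (measurableSet_lt measurable_fst measurable_snd))
    _ = _ := by
      refine setLIntegral_congr_fun measurableSet_Ioi fun τ _ => ?_
      have : ∀ t, w t * (Set.Ioi t).indicator g τ = (Set.Iio τ).indicator (fun t => w t * g τ) t := by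
        intro t
        by_cases h : t < τ <;> simp [Set.indicator, h]
      simp_rw [this]
      rw [setLIntegral_indicator measurableSet_Iio, Set.inter_comm, Set.Ioi_inter_Iio,
        lintegral_mul_const _ hw]
      simp only [g]
      ring

/-- A new coordinate not seen by the weight `A` adds an independent exponential variable to `-log`
of the product, which replaces `w` by its primitive. This is the inductive step for both laws below.
-/
theorem lintegral_openCube_succ {n : ℕ} {A : (Fin n → ℝ) → ℝ≥0∞} {w : ℝ → ℝ≥0∞}
    (hA : Measurable A) (hw : Measurable w)
    (h : ∀ F : ℝ → ℝ≥0∞, Measurable F → ∫⁻ x in openCube n, A x * F (-Real.log (∏ j, x j))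
      = ∫⁻ t in Set.Ioi (0 : ℝ), ENNReal.ofReal (Real.exp (-t)) * w t * F t)
    {F : ℝ → ℝ≥0∞} (hF : Measurable F) :
    ∫⁻ x in openCube (n + 1), A (Fin.init x) * F (-Real.log (∏ j, x j))
      = ∫⁻ t in Set.Ioi (0 : ℝ),
          ENNReal.ofReal (Real.exp (-t)) * (∫⁻ r in Set.Ioo 0 t, w r) * F t := by
  let e := MeasurableEquiv.piFinSuccAbove (fun _ : Fin (n + 1) => ℝ) (Fin.last n)
  have he : MeasurePreserving e := volume_preserving_piFinSuccAbove _ _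
  have hpre : openCube (n + 1) = e ⁻¹' (Set.Ioo (0 : ℝ) 1 ×ˢ openCube n) := by
    ext x
    simp only [openCube, e, Set.mem_pi, Set.mem_univ, true_implies,
      Fin.forall_fin_succ', Set.mem_preimage, Set.mem_prod, and_comm (a := ∀ i : Fin n, _)]
    simp
    exact fun _ _ => Iff.rfl
  let G : ℝ × (Fin n → ℝ) → ℝ≥0∞ := fun p => A p.2 * F (-Real.log ((∏ j, p.2 j) * p.1))
  have hG : Measurable G := by fun_prop
  have hcomp : ∀ x, A (Fin.init x) * F (-Real.log (∏ j, x j)) = G (e x) := by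
    intro x
    simp only [G, e, Fin.prod_univ_castSucc]
    simp
    rfl
  simp_rw [hcomp]
  rw [hpre, he.setLIntegral_comp_preimage (measurableSet_Ioo.prod (measurableSet_openCube n)) hG,
    Measure.volume_eq_prod, ← Measure.prod_restrict, lintegral_prod _ hG.aemeasurable,
    ← lintegral_sub_log_eq hw hF]
  refine setLIntegral_congr_fun measurableSet_Ioo fun y hy => ?_
  simp only [G]
  rw [← h (fun t => F (t - Real.log y)) (by fun_prop)]
  refine setLIntegral_congr_fun (measurableSet_openCube n) fun x hx => ?_
  have hx0 : (∏ j, x j) ≠ 0 := Finset.prod_ne_zero_iff.2 fun j _ => (hx j trivial).1.ne'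
  rw [Real.log_mul hx0 hy.1.ne', neg_add, sub_eq_add_neg]

theorem lintegral_Ioo_ofReal_of_hasDerivAt {W w : ℝ → ℝ} (hd : ∀ t, HasDerivAt W (w t) t)
    (hw : Continuous w) (h0 : ∀ t, 0 < t → 0 ≤ w t) (hW : W 0 = 0) {t : ℝ} (ht : 0 < t) :
    ∫⁻ r in Set.Ioo 0 t, ENNReal.ofReal (w r) = ENNReal.ofReal (W t) := by
  have hi : IntegrableOn w (Set.Ioo 0 t) :=
    (hw.continuousOn.integrableOn_Icc (a := 0) (b := t)).mono_set Set.Ioo_subset_Icc_self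
  rw [← ofReal_integral_eq_lintegral_ofReal hi
    ((ae_restrict_iff' measurableSet_Ioo).2 (ae_of_all _ fun r hr => h0 r hr.1)),
    ← integral_Ioc_eq_integral_Ioo, ← intervalIntegral.integral_of_le ht.le,
    intervalIntegral.integral_eq_sub_of_hasDerivAt (fun x _ => hd x) (hw.intervalIntegrable _ _),
    hW, sub_zero]

/-- The density of `-log (x₁ ⋯ x_{n+1})`, up to the factor `e⁻ᵗ`. -/
def gammaWeight (n : ℕ) (t : ℝ) : ℝ := t ^ n / n.factorial

/-- The density of `-log (x₁ ⋯ x_{n+1})` under the weight `n - x₁ - ⋯ - x₁⋯x_n`, up to the factor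
`e⁻ᵗ`. -/
def deficitWeight (n : ℕ) (t : ℝ) : ℝ :=
  n * (t ^ n - t ^ (n - 1) * (1 - Real.exp (-t))) / n.factorial

/-- The weight `m - 1 - x₁ - ⋯ - x₁⋯x_{m-1}`. -/
def partialProdDeficit {m : ℕ} (x : Fin m → ℝ) : ℝ :=
  (m : ℝ) - 1 - ∑ k ∈ Finset.Icc 1 (m - 1), partialProd x k

theorem hasDerivAt_gammaWeight (n : ℕ) (t : ℝ) :
    HasDerivAt (gammaWeight (n + 1)) (gammaWeight n t) t := by
  have := (hasDerivAt_pow (n + 1) t).div_const ((n + 1).factorial : ℝ)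
  refine this.congr_deriv ?_
  rw [gammaWeight, Nat.factorial_succ]
  have : (n.factorial : ℝ) ≠ 0 := by positivity
  push_cast
  field_simp

/-- This is the recursion of the weighted law: the added term `1 - x₁⋯x_{n+1}` equals `1 - e⁻ᵗ` and
comes with the unweighted Gamma density. -/
theorem hasDerivAt_deficitWeight (n : ℕ) (t : ℝ) :
    HasDerivAt (deficitWeight (n + 1))
      (deficitWeight n t + (1 - Real.exp (-t)) * gammaWeight n t) t := by
  have he : HasDerivAt (fun t : ℝ => 1 - Real.exp (-t)) (Real.exp (-t)) t := by
    have := ((hasDerivAt_neg t).exp).const_sub 1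
    simpa using this
  have := ((((hasDerivAt_pow (n + 1) t).sub ((hasDerivAt_pow n t).mul he)).const_mul
    (((n + 1 : ℕ) : ℝ))).div_const ((n + 1).factorial : ℝ))
  refine this.congr_deriv ?_
  rw [gammaWeight, deficitWeight, Nat.factorial_succ]
  have : (n.factorial : ℝ) ≠ 0 := by positivity
  push_cast
  field_simp
  ring

theorem gammaWeight_nonneg (n : ℕ) {t : ℝ} (ht : 0 < t) : 0 ≤ gammaWeight n t := by
  unfold gammaWeight; positivity

theorem deficitWeight_nonneg (n : ℕ) {t : ℝ} (ht : 0 < t) : 0 ≤ deficitWeight n t := by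
  unfold deficitWeight
  -- At `n = 0` the leading factor `n` kills the weight, so the truncated exponent `n - 1` is
  -- harmless.
  rcases n with _ | n
  · simp
  · have h1 : 1 - Real.exp (-t) ≤ t := by linarith [Real.add_one_le_exp (-t)]
    have h2 : 0 ≤ t ^ n * (t - (1 - Real.exp (-t))) := by
      have : 0 ≤ t - (1 - Real.exp (-t)) := by linarith
      positivity
    have h3 : 0 ≤ t ^ (n + 1) - t ^ (n + 1 - 1) * (1 - Real.exp (-t)) := by
      simp only [Nat.add_sub_cancel, pow_succ]; linarith
    positivity

theorem continuous_gammaWeight (n : ℕ) : Continuous (gammaWeight n) := by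
  unfold gammaWeight; fun_prop

theorem continuous_deficitWeight (n : ℕ) : Continuous (deficitWeight n) := by
  unfold deficitWeight; fun_prop

theorem partialProd_init {n k : ℕ} (x : Fin (n + 1) → ℝ) (hk : k ≤ n) :
    partialProd x k = partialProd (Fin.init x) k := by
  simp only [partialProd, Finset.prod_filter, Fin.prod_univ_castSucc]
  simp [Fin.init, hk]

theorem partialProd_self {n : ℕ} (x : Fin n → ℝ) : partialProd x n = ∏ j, x j := by
  simp [partialProd]

theorem partialProdDeficit_succ {n : ℕ} (x : Fin (n + 2) → ℝ) :
    partialProdDeficit x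
      = partialProdDeficit (Fin.init x : Fin (n + 1) → ℝ) + (1 - ∏ j, (Fin.init x) j) := by
  simp only [partialProdDeficit, Nat.add_sub_cancel, Nat.add_succ_sub_one]
  rw [Finset.sum_Icc_succ_top (by omega), partialProd_init x le_rfl, partialProd_self,
    Finset.sum_congr rfl fun k hk => partialProd_init x
      ((Finset.mem_Icc.1 hk).2.trans (Nat.le_succ n))]
  push_cast
  ring

theorem prod_mem_Ioo_of_mem_openCube {n : ℕ} {x : Fin (n + 1) → ℝ} (hx : x ∈ openCube (n + 1)) :
    (∏ j, x j) ∈ Set.Ioo (0 : ℝ) 1 := by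
  refine ⟨Finset.prod_pos fun j _ => (hx j trivial).1, ?_⟩
  rw [Fin.prod_univ_castSucc]
  have h1 : ∏ j : Fin n, x j.castSucc ≤ 1 :=
    Finset.prod_le_one (fun j _ => (hx _ trivial).1.le) fun j _ => (hx _ trivial).2.le
  have h2 := hx (Fin.last n) trivial
  calc _ ≤ 1 * x (Fin.last n) := by gcongr; exact h2.1.le
    _ < 1 := by linarith [h2.2]

theorem partialProdDeficit_nonneg {n : ℕ} {x : Fin (n + 1) → ℝ} (hx : x ∈ openCube (n + 1)) :
    0 ≤ partialProdDeficit x := by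
  have : ∑ k ∈ Finset.Icc 1 n, partialProd x k ≤ ∑ k ∈ Finset.Icc 1 n, (1 : ℝ) :=
    Finset.sum_le_sum fun k _ => Finset.prod_le_one (fun j _ => (hx _ trivial).1.le)
      fun j _ => (hx _ trivial).2.le
  simp [partialProdDeficit] at this ⊢
  linarith

theorem measurable_partialProdDeficit (n : ℕ) :
    Measurable (partialProdDeficit : (Fin n → ℝ) → ℝ) := by
  unfold partialProdDeficit partialProd; fun_prop

/-- A sum of `n + 1` independent exponentials has a Gamma law. -/
theorem lintegral_openCube_gammaWeight (n : ℕ) {F : ℝ → ℝ≥0∞} (hF : Measurable F) :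
    ∫⁻ x in openCube (n + 1), F (-Real.log (∏ j, x j))
      = ∫⁻ t in Set.Ioi (0 : ℝ),
          ENNReal.ofReal (Real.exp (-t)) * ENNReal.ofReal (gammaWeight n t) * F t := by
  induction n generalizing F with
  | zero =>
    have he : MeasurePreserving (MeasurableEquiv.funUnique (Fin 1) ℝ) :=
      volume_preserving_funUnique _ _
    have hpre : openCube 1 = MeasurableEquiv.funUnique (Fin 1) ℝ ⁻¹' (Set.Ioo (0 : ℝ) 1) := by
      ext x
      simp [openCube]
    have hG : Measurable fun y : ℝ => F (-Real.log y) := by fun_prop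
    have := he.setLIntegral_comp_preimage (measurableSet_Ioo (a := (0 : ℝ)) (b := 1)) hG
    rw [← hpre] at this
    simp only [MeasurableEquiv.funUnique_apply] at this
    have hprod : ∀ x : Fin (0 + 1) → ℝ, ∏ j, x j = x default := fun x => by simp
    simp_rw [hprod]
    refine this.trans ?_
    rw [lintegral_Ioo_eq_lintegral_exp_neg]
    simp [gammaWeight]
  | succ n ih =>
    have := lintegral_openCube_succ (A := fun _ => 1) (w := fun t => ENNReal.ofReal (gammaWeight n t))
      measurable_const (continuous_gammaWeight n).measurable.ennreal_ofReal
      (fun F hF => by simpa using ih hF) hF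
    simp only [one_mul] at this
    rw [this]
    refine setLIntegral_congr_fun measurableSet_Ioi fun t ht => ?_
    rw [lintegral_Ioo_ofReal_of_hasDerivAt (hasDerivAt_gammaWeight n) (continuous_gammaWeight n)
      (fun _ => gammaWeight_nonneg n) (by simp [gammaWeight]) ht]

/-- By `partialProdDeficit_succ` the weight never involves the last coordinate. It splits into the
previous deficit, covered by induction, and `1 - ∏`, a function of `t` covered by the Gamma law; the
last coordinate then integrates the sum of the two densities. -/
theorem lintegral_openCube_deficitWeight (n : ℕ) {F : ℝ → ℝ≥0∞} (hF : Measurable F) :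
    ∫⁻ x in openCube (n + 1),
        ENNReal.ofReal (partialProdDeficit x) * F (-Real.log (∏ j, x j))
      = ∫⁻ t in Set.Ioi (0 : ℝ),
          ENNReal.ofReal (Real.exp (-t)) * ENNReal.ofReal (deficitWeight n t) * F t := by
  induction n generalizing F with
  | zero => simp [partialProdDeficit, deficitWeight]
  | succ n ih =>
    let A : (Fin (n + 1) → ℝ) → ℝ≥0∞ := fun x => ENNReal.ofReal (partialProdDeficit x)
      + ENNReal.ofReal (1 - ∏ j, x j)
    let w : ℝ → ℝ := fun t => deficitWeight n t + (1 - Real.exp (-t)) * gammaWeight n t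
    have hw : Continuous w := by
      have := continuous_deficitWeight n
      have := continuous_gammaWeight n
      fun_prop
    have hexp : ∀ t : ℝ, 0 < t → 0 ≤ 1 - Real.exp (-t) := fun t ht =>
      sub_nonneg.2 (Real.exp_le_one_iff.2 (by linarith))
    have hw0 : ∀ t : ℝ, 0 < t → 0 ≤ w t := fun t ht =>
      add_nonneg (deficitWeight_nonneg n ht) (mul_nonneg (hexp t ht) (gammaWeight_nonneg n ht))
    have hA : Measurable A := by
      have := measurable_partialProdDeficit (n + 1)
      fun_prop
    have key := lintegral_openCube_succ (A := A) (w := fun t => ENNReal.ofReal (w t)) hA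
      hw.measurable.ennreal_ofReal ?_ hF
    · have hL : ∫⁻ x in openCube (n + 1 + 1),
          ENNReal.ofReal (partialProdDeficit x) * F (-Real.log (∏ j, x j))
          = ∫⁻ x in openCube (n + 1 + 1), A (Fin.init x) * F (-Real.log (∏ j, x j)) := by
        refine setLIntegral_congr_fun (measurableSet_openCube _) fun x hx => ?_
        have hx' : (Fin.init x : Fin (n + 1) → ℝ) ∈ openCube (n + 1) := fun j _ => hx _ trivial
        simp only [A]
        rw [partialProdDeficit_succ, ENNReal.ofReal_add (partialProdDeficit_nonneg hx')
          (sub_nonneg.2 (prod_mem_Ioo_of_mem_openCube hx').2.le)]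
      rw [hL, key]
      refine setLIntegral_congr_fun measurableSet_Ioi fun t ht => ?_
      rw [lintegral_Ioo_ofReal_of_hasDerivAt (hasDerivAt_deficitWeight n) hw hw0
        (by simp [deficitWeight]) ht]
    · intro F hF
      have h1 := ih hF
      have h2 := lintegral_openCube_gammaWeight n
        (F := fun t => ENNReal.ofReal (1 - Real.exp (-t)) * F t) (by fun_prop)
      have hm := measurable_partialProdDeficit (n + 1)
      have hd := (continuous_deficitWeight n).measurable
      have hg := (continuous_gammaWeight n).measurable
      have h3 : ∫⁻ x in openCube (n + 1), A x * F (-Real.log (∏ j, x j))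
          = ∫⁻ x in openCube (n + 1),
              (ENNReal.ofReal (partialProdDeficit x) * F (-Real.log (∏ j, x j))
              + ENNReal.ofReal (1 - Real.exp (-(-Real.log (∏ j, x j))))
                * F (-Real.log (∏ j, x j))) := by
        refine setLIntegral_congr_fun (measurableSet_openCube _) fun x hx => ?_
        simp only [A]
        rw [neg_neg, Real.exp_log (prod_mem_Ioo_of_mem_openCube hx).1, add_mul]
      rw [h3, lintegral_add_left (by fun_prop), h1, h2, ← lintegral_add_left (by fun_prop)]
      refine setLIntegral_congr_fun measurableSet_Ioi fun t ht => ?_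
      simp only [w]
      rw [ENNReal.ofReal_add (deficitWeight_nonneg n ht)
        (mul_nonneg (hexp t ht) (gammaWeight_nonneg n ht)), ENNReal.ofReal_mul (hexp t ht)]
      ring

/-- The law as an identity of measures, from which integrability and complex integrals transfer by
general pushforward results. -/
theorem map_deficit_openCube (n : ℕ) :
    ((volume.restrict (openCube (n + 1))).withDensity
        fun x => ENNReal.ofReal (partialProdDeficit x)).map (fun x => -Real.log (∏ j, x j))
      = (volume.restrict (Set.Ioi 0)).withDensity
          fun t => ENNReal.ofReal (Real.exp (-t) * deficitWeight n t) := by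
  have hm := measurable_partialProdDeficit (n + 1)
  have hd := (continuous_deficitWeight n).measurable
  refine Measure.ext_of_lintegral _ fun F hF => ?_
  rw [lintegral_map hF (by fun_prop), lintegral_withDensity_eq_lintegral_mul _ (by fun_prop)
    (by fun_prop), lintegral_withDensity_eq_lintegral_mul _ (by fun_prop) hF]
  refine (lintegral_openCube_deficitWeight n hF).trans (lintegral_congr fun t => ?_)
  simp only [Pi.mul_apply]
  rw [ENNReal.ofReal_mul (Real.exp_pos _).le]

theorem restrict_Icc_eq_restrict_openCube (n : ℕ) :
    (volume : Measure (Fin n → ℝ)).restrict (Set.Icc 0 1) = volume.restrict (openCube n) :=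
  (Measure.restrict_congr_set Measure.univ_pi_Ioo_ae_eq_Icc).symm

theorem integrable_openCube_deficit_iff (n : ℕ) {H : ℝ → ℂ} (hH : Measurable H) :
    IntegrableOn (fun x => partialProdDeficit x • H (-Real.log (∏ j, x j))) (openCube (n + 1))
      ↔ IntegrableOn (fun t => (Real.exp (-t) * deficitWeight n t) • H t) (Set.Ioi 0) := by
  have hm := measurable_partialProdDeficit (n + 1)
  have hd := (continuous_deficitWeight n).measurable
  have h := integrable_map_measure (μ := (volume.restrict (openCube (n + 1))).withDensity
        fun x => ENNReal.ofReal (partialProdDeficit x)) (f := fun x => -Real.log (∏ j, x j))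
        (g := H) hH.aestronglyMeasurable (by fun_prop)
  rw [map_deficit_openCube, integrable_withDensity_iff_integrable_smul' (by fun_prop)
    (ae_of_all _ fun _ => ENNReal.ofReal_lt_top),
    integrable_withDensity_iff_integrable_smul' (by fun_prop)
    (ae_of_all _ fun _ => ENNReal.ofReal_lt_top)] at h
  unfold IntegrableOn
  rw [integrable_congr (g := fun t => (ENNReal.ofReal (Real.exp (-t) * deficitWeight n t)).toReal
    • H t), h]
  · refine integrable_congr ((ae_restrict_iff' (measurableSet_openCube _)).2
      (ae_of_all _ fun x hx => ?_))
    simp [ENNReal.toReal_ofReal (partialProdDeficit_nonneg hx)]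
  · refine (ae_restrict_iff' measurableSet_Ioi).2 (ae_of_all _ fun t ht => ?_)
    simp only
    rw [ENNReal.toReal_ofReal (mul_nonneg (Real.exp_pos _).le (deficitWeight_nonneg n ht))]

theorem integral_openCube_deficit (n : ℕ) {H : ℝ → ℂ} (hH : Measurable H) :
    ∫ x in openCube (n + 1), partialProdDeficit x • H (-Real.log (∏ j, x j))
      = ∫ t in Set.Ioi 0, (Real.exp (-t) * deficitWeight n t) • H t := by
  have hm := measurable_partialProdDeficit (n + 1)
  have hd := (continuous_deficitWeight n).measurable
  have h := integral_map (μ := (volume.restrict (openCube (n + 1))).withDensity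
        fun x => ENNReal.ofReal (partialProdDeficit x)) (φ := fun x => -Real.log (∏ j, x j))
        (f := H) (by fun_prop) hH.aestronglyMeasurable
  rw [map_deficit_openCube, integral_withDensity_eq_integral_toReal_smul (by fun_prop)
    (ae_of_all _ fun _ => ENNReal.ofReal_lt_top),
    integral_withDensity_eq_integral_toReal_smul (by fun_prop)
    (ae_of_all _ fun _ => ENNReal.ofReal_lt_top)] at h
  rw [setIntegral_congr_fun (g := fun x => (ENNReal.ofReal (partialProdDeficit x)).toReal
    • H (-Real.log (∏ j, x j))) (measurableSet_openCube _), ← h]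
  · refine setIntegral_congr_fun measurableSet_Ioi fun t ht => ?_
    rw [ENNReal.toReal_ofReal (mul_nonneg (Real.exp_pos _).le (deficitWeight_nonneg n ht))]
  · intro x hx
    simp [ENNReal.toReal_ofReal (partialProdDeficit_nonneg hx)]

/-! ### The cut plane -/

theorem mem_cutPlane_iff {z : ℂ} : z ∈ cutPlane ↔ 1 - z ∈ Complex.slitPlane := by
  simp only [cutPlane, Set.mem_compl_iff, Set.mem_image, Set.mem_Ici, Complex.mem_slitPlane_iff,
    Complex.sub_re, Complex.one_re, Complex.sub_im, Complex.one_im, zero_sub, neg_ne_zero]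
  constructor
  · intro h
    by_contra! hc
    exact h ⟨z.re, by linarith [hc.1], Complex.ext (by simp) (by simp [hc.2])⟩
  · rintro h ⟨r, hr, rfl⟩
    simp at h
    linarith

theorem isOpen_cutPlane : IsOpen cutPlane := by
  have : cutPlane = (fun z : ℂ => 1 - z) ⁻¹' Complex.slitPlane := Set.ext fun _ => mem_cutPlane_iff
  rw [this]
  exact Complex.isOpen_slitPlane.preimage (by fun_prop)

theorem one_notMem_cutPlane : (1 : ℂ) ∉ cutPlane := by simp [mem_cutPlane_iff]

theorem ball_subset_cutPlane : Metric.ball (0 : ℂ) 1 ⊆ cutPlane := by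
  intro z hz
  rw [mem_cutPlane_iff, sub_eq_add_neg]
  exact Complex.mem_slitPlane_of_norm_lt_one (by simpa using hz)

/-- The cut plane is star-shaped about `0`. Hence `1 - z e⁻ᵗ` never vanishes, and the plane is
connected. -/
theorem one_sub_mul_mem_slitPlane {z : ℂ} (hz : z ∈ cutPlane) {y : ℝ} (hy : y ∈ Set.Icc (0 : ℝ) 1) :
    1 - z * y ∈ Complex.slitPlane := by
  rw [mem_cutPlane_iff, Complex.mem_slitPlane_iff] at hz
  rw [Complex.mem_slitPlane_iff]
  rcases hy.1.eq_or_lt with h0 | h0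
  · left; simp [← h0]
  · rcases hz with hz | hz
    · left
      simp at hz ⊢
      rcases le_or_gt z.re 0 with h | h
      · nlinarith [hy.2]
      · nlinarith [hy.2]
    · right
      simp at hz ⊢
      exact ⟨hz, h0.ne'⟩

theorem isPreconnected_cutPlane : IsPreconnected cutPlane := by
  refine (StarConvex.isPathConnected (a := (0 : ℂ)) ?_
    (ball_subset_cutPlane (by simp))).isConnected.isPreconnected
  rw [starConvex_zero_iff]
  intro z hz a ha0 ha1
  rw [mem_cutPlane_iff]
  have := one_sub_mul_mem_slitPlane hz ⟨ha0, ha1⟩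
  rwa [mul_comm] at this

/-- By compactness `‖1 - z₀ y‖` has a positive minimum on `[0, 1]`; moving `z₀` by less than half of
it leaves the other half as `c`. -/
theorem eventually_le_norm_one_sub_mul {z₀ : ℂ} (hz : z₀ ∈ cutPlane) :
    ∃ c : ℝ, 0 < c ∧ ∀ᶠ z : ℂ in 𝓝 z₀, ∀ y ∈ Set.Icc (0 : ℝ) 1, c ≤ ‖1 - z * y‖ := by
  obtain ⟨y₀, hy₀, hmin⟩ := isCompact_Icc.exists_isMinOn (Set.nonempty_Icc.2 zero_le_one)
    (f := fun y : ℝ => ‖1 - z₀ * y‖) (by fun_prop : Continuous _).continuousOn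
  have hpos : 0 < ‖1 - z₀ * y₀‖ :=
    norm_pos_iff.2 (Complex.slitPlane_ne_zero (one_sub_mul_mem_slitPlane hz hy₀))
  refine ⟨‖1 - z₀ * y₀‖ / 2, by positivity, ?_⟩
  filter_upwards [Metric.ball_mem_nhds z₀ (half_pos hpos)] with z hz y hy
  have h1 : ‖1 - z₀ * y₀‖ ≤ ‖1 - z₀ * y‖ := hmin hy
  have h2 : ‖1 - z₀ * y‖ ≤ ‖1 - z * y‖ + ‖(z - z₀) * y‖ := by
    rw [show (1 : ℂ) - z₀ * y = (1 - z * y) + (z - z₀) * y by ring]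
    exact norm_add_le _ _
  have h3 : ‖(z - z₀) * y‖ ≤ ‖z - z₀‖ := by
    rw [norm_mul, Complex.norm_real, Real.norm_of_nonneg hy.1]
    exact mul_le_of_le_one_right (norm_nonneg _) hy.2
  rw [mem_ball_iff_norm] at hz
  linarith

/-! ### Integrals against `1 / (1 - z e⁻ᵗ)` -/

theorem exp_neg_mem_Icc {t : ℝ} (ht : 0 < t) : Real.exp (-t) ∈ Set.Icc (0 : ℝ) 1 :=
  ⟨(Real.exp_pos _).le, Real.exp_le_one_iff.2 (by linarith)⟩

/-- Geometric expansion under dominated convergence. Assuming only that the summed majorant is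
integrable lets it serve at `z = 1` as well as inside the disc. -/
theorem hasSum_integral_div_one_sub {h : ℝ → ℂ} {z : ℂ} (hz : ‖z‖ ≤ 1)
    (hh : AEStronglyMeasurable h (volume.restrict (Set.Ioi 0)))
    (hi : IntegrableOn (fun t => ‖h t‖ / (1 - ‖z‖ * Real.exp (-t))) (Set.Ioi 0)) :
    HasSum (fun n : ℕ => z ^ n * ∫ t in Set.Ioi (0 : ℝ), Complex.exp (-(n * t)) * h t)
      (∫ t in Set.Ioi (0 : ℝ), h t / (1 - z * Real.exp (-t))) := by
  have hq : ∀ t : ℝ, 0 < t → ‖z‖ * Real.exp (-t) < 1 := fun t ht =>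
    calc _ ≤ 1 * Real.exp (-t) := by gcongr
      _ < 1 := by rw [one_mul]; exact Real.exp_lt_one_iff.2 (by linarith)
  have hsum : ∀ t : ℝ, 0 < t → HasSum (fun n : ℕ => ‖h t‖ * (‖z‖ * Real.exp (-t)) ^ n)
      (‖h t‖ / (1 - ‖z‖ * Real.exp (-t))) := fun t ht => by
    rw [div_eq_mul_inv]
    exact (hasSum_geometric_of_lt_one (by positivity) (hq t ht)).mul_left _
  have hexp : ∀ (n : ℕ) (t : ℝ), Complex.exp (-(n * t)) = (Real.exp (-t) : ℂ) ^ n := by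
    intro n t
    rw [Complex.ofReal_exp, ← Complex.exp_nat_mul]
    push_cast; ring_nf
  simp_rw [← integral_const_mul]
  refine hasSum_integral_of_dominated_convergence
    (fun n t => ‖h t‖ * (‖z‖ * Real.exp (-t)) ^ n) ?_ ?_ ?_ ?_ ?_
  · intro n
    exact AEStronglyMeasurable.const_mul
      (AEStronglyMeasurable.mul (by fun_prop : Continuous _).aestronglyMeasurable hh) _
  · refine fun n => ae_of_all _ fun t => le_of_eq ?_
    rw [hexp, norm_mul, norm_mul, norm_pow, norm_pow, Complex.norm_real,
      Real.norm_of_nonneg (Real.exp_pos _).le, mul_pow]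
    ring
  · exact (ae_restrict_iff' measurableSet_Ioi).2 (ae_of_all _ fun t ht => (hsum t ht).summable)
  · refine hi.congr_fun (fun t ht => ((hsum t ht).tsum_eq).symm) measurableSet_Ioi
  · refine (ae_restrict_iff' measurableSet_Ioi).2 (ae_of_all _ fun t ht => ?_)
    have hlt : ‖z * Real.exp (-t)‖ < 1 := by
      rw [norm_mul, Complex.norm_real, Real.norm_of_nonneg (Real.exp_pos _).le]
      exact hq t ht
    have := (hasSum_geometric_of_norm_lt_one hlt).mul_left (h t)
    rw [← div_eq_mul_inv] at this
    refine this.congr_fun fun n => ?_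
    rw [hexp, mul_pow]
    ring

theorem hasSum_integral_div_one_sub_of_norm_lt_one {h : ℝ → ℂ} {z : ℂ} (hz : ‖z‖ < 1)
    (hh : IntegrableOn h (Set.Ioi 0)) :
    HasSum (fun n : ℕ => z ^ n * ∫ t in Set.Ioi (0 : ℝ), Complex.exp (-(n * t)) * h t)
      (∫ t in Set.Ioi (0 : ℝ), h t / (1 - z * Real.exp (-t))) := by
  refine hasSum_integral_div_one_sub hz.le hh.aestronglyMeasurable ?_
  refine Integrable.mono' (hh.norm.div_const (1 - ‖z‖)) ?_ ?_
  · exact hh.norm.aestronglyMeasurable.div₀ (by fun_prop : Continuous _).aestronglyMeasurable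
  · refine (ae_restrict_iff' measurableSet_Ioi).2 (ae_of_all _ fun t ht => ?_)
    have h1 : ‖z‖ * Real.exp (-t) ≤ ‖z‖ :=
      mul_le_of_le_one_right (norm_nonneg _) (exp_neg_mem_Icc ht).2
    have h2 : 0 < 1 - ‖z‖ := by linarith
    rw [Real.norm_of_nonneg (div_nonneg (norm_nonneg _) (by linarith))]
    gcongr

theorem analyticOnNhd_integral_div_one_sub {h : ℝ → ℂ} (hh : IntegrableOn h (Set.Ioi 0)) :
    AnalyticOnNhd ℂ (fun z : ℂ => ∫ t in Set.Ioi (0 : ℝ), h t / (1 - z * Real.exp (-t)))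
      cutPlane := by
  refine DifferentiableOn.analyticOnNhd (fun z₀ hz₀ => ?_) isOpen_cutPlane
  obtain ⟨c, hc, hev⟩ := eventually_le_norm_one_sub_mul hz₀
  have hmeas : ∀ z : ℂ, AEStronglyMeasurable (fun t : ℝ => h t / (1 - z * Real.exp (-t)))
      (volume.restrict (Set.Ioi 0)) := fun z =>
    hh.aestronglyMeasurable.div₀ (by fun_prop : Continuous _).aestronglyMeasurable
  refine (DifferentiableAt.differentiableWithinAt (HasDerivAt.differentiableAt
    (hasDerivAt_integral_of_dominated_loc_of_deriv_le (bound := fun t => ‖h t‖ / c ^ 2)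
    (F' := fun z t => h t * Real.exp (-t) / (1 - z * Real.exp (-t)) ^ 2)
    hev (Eventually.of_forall hmeas) ?_ ?_ ?_ (hh.norm.div_const _) ?_).2))
  · refine Integrable.mono' (hh.norm.div_const c) (hmeas z₀) ?_
    refine (ae_restrict_iff' measurableSet_Ioi).2 (ae_of_all _ fun t ht => ?_)
    rw [norm_div]
    have := hev.self_of_nhds _ (exp_neg_mem_Icc ht)
    gcongr
  · exact (hh.aestronglyMeasurable.mul (by fun_prop : Continuous _).aestronglyMeasurable).div₀
      (by fun_prop : Continuous _).aestronglyMeasurable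
  · refine (ae_restrict_iff' measurableSet_Ioi).2 (ae_of_all _ fun t ht z hz => ?_)
    have := hz _ (exp_neg_mem_Icc ht)
    rw [norm_div, norm_mul, norm_pow, Complex.norm_real, Real.norm_of_nonneg (Real.exp_pos _).le]
    have h1 : ‖h t‖ * Real.exp (-t) ≤ ‖h t‖ :=
      mul_le_of_le_one_right (norm_nonneg _) (exp_neg_mem_Icc ht).2
    gcongr
  · refine (ae_restrict_iff' measurableSet_Ioi).2 (ae_of_all _ fun t ht z hz => ?_)
    have hne : 1 - z * (Real.exp (-t) : ℂ) ≠ 0 :=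
      norm_pos_iff.1 (hc.trans_le (hz _ (exp_neg_mem_Icc ht)))
    have := (((hasDerivAt_id z).mul_const (Real.exp (-t) : ℂ)).const_sub 1).inv hne
    have := this.const_mul (h t)
    simp only [id, one_mul, neg_neg] at this
    simp only [div_eq_mul_inv (h t)]
    refine this.congr_deriv ?_
    ring

/-! ### The Gamma integral with a complex rate -/

theorem integrableOn_rpow_mul_exp_neg_mul {p b : ℝ} (hp : -1 < p) (hb : 0 < b) :
    IntegrableOn (fun t : ℝ => t ^ p * Real.exp (-b * t)) (Set.Ioi 0) := by
  simpa using integrableOn_rpow_mul_exp_neg_mul_rpow hp zero_lt_one hb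

theorem norm_exp_neg_mul_ofReal (v : ℂ) (t : ℝ) :
    ‖Complex.exp (-(v * t))‖ = Real.exp (-v.re * t) := by
  simp [Complex.norm_exp]

theorem aestronglyMeasurable_cpow_mul_exp (a v : ℂ) :
    AEStronglyMeasurable (fun t : ℝ => (t : ℂ) ^ a * Complex.exp (-(v * t)))
      (volume.restrict (Set.Ioi 0)) := by
  have : Measurable (fun t : ℝ => (t : ℂ) ^ a) := by fun_prop
  exact (by fun_prop : Measurable fun t : ℝ =>
    (t : ℂ) ^ a * Complex.exp (-(v * t))).aestronglyMeasurable

theorem integrableOn_cpow_mul_exp_neg_mul {a v : ℂ} (ha : -1 < a.re) (hv : 0 < v.re) :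
    IntegrableOn (fun t : ℝ => (t : ℂ) ^ a * Complex.exp (-(v * t))) (Set.Ioi 0) := by
  refine Integrable.mono' (integrableOn_rpow_mul_exp_neg_mul ha hv)
    (aestronglyMeasurable_cpow_mul_exp a v) ?_
  refine (ae_restrict_iff' measurableSet_Ioi).2 (ae_of_all _ fun t ht => ?_)
  rw [norm_mul, norm_exp_neg_mul_ofReal, Complex.norm_cpow_eq_rpow_re_of_pos ht]

theorem isOpen_re_gt (c : ℝ) : IsOpen {w : ℂ | c < w.re} :=
  isOpen_lt continuous_const Complex.continuous_re

theorem isPreconnected_re_gt (c : ℝ) : IsPreconnected {w : ℂ | c < w.re} :=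
  (convex_halfSpace_re_gt c).isPreconnected

theorem differentiableAt_integral_cpow_mul_exp {a v₀ : ℂ} (ha : -1 < a.re) (hv : 0 < v₀.re) :
    DifferentiableAt ℂ
      (fun v : ℂ => ∫ t in Set.Ioi (0 : ℝ), (t : ℂ) ^ a * Complex.exp (-(v * t))) v₀ := by
  refine HasDerivAt.differentiableAt
    (hasDerivAt_integral_of_dominated_loc_of_deriv_le
    (bound := fun t => t ^ (a.re + 1) * Real.exp (-(v₀.re / 2) * t))
    (F' := fun v t => -((t : ℂ) ^ a * t * Complex.exp (-(v * t))))
    ((isOpen_re_gt (v₀.re / 2)).mem_nhds (half_lt_self hv))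
    (Eventually.of_forall fun v => aestronglyMeasurable_cpow_mul_exp a v)
    (integrableOn_cpow_mul_exp_neg_mul ha hv) ?_ ?_
    (integrableOn_rpow_mul_exp_neg_mul (by linarith) (half_pos hv)) ?_).2
  · have : Measurable (fun t : ℝ => (t : ℂ) ^ a) := by fun_prop
    exact (by fun_prop : Measurable fun t : ℝ =>
      -((t : ℂ) ^ a * t * Complex.exp (-(v₀ * t)))).aestronglyMeasurable
  · refine (ae_restrict_iff' measurableSet_Ioi).2 (ae_of_all _ fun t ht v hv => ?_)
    have ht' : (0 : ℝ) < t := ht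
    have hv' : v₀.re / 2 < v.re := hv
    rw [norm_neg, norm_mul, norm_mul, norm_exp_neg_mul_ofReal,
      Complex.norm_cpow_eq_rpow_re_of_pos ht, Complex.norm_real, Real.norm_of_nonneg ht'.le,
      Real.rpow_add ht', Real.rpow_one]
    gcongr
  · refine (ae_restrict_iff' measurableSet_Ioi).2 (ae_of_all _ fun t ht v hv => ?_)
    have := ((((hasDerivAt_id v).mul_const (t : ℂ)).neg).cexp).const_mul ((t : ℂ) ^ a)
    simp only [id, one_mul] at this
    refine this.congr_deriv ?_
    simp only [Pi.neg_apply]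
    ring

/-- Both sides are analytic in `v` on the right half-plane and agree at positive reals, in
particular along `1 + 1/(n+1) → 1`. -/
theorem integral_cpow_mul_exp_neg_complex_mul {a v : ℂ} (ha : 0 < a.re) (hv : 0 < v.re) :
    ∫ t in Set.Ioi (0 : ℝ), (t : ℂ) ^ (a - 1) * Complex.exp (-(v * t))
      = Complex.Gamma a * v ^ (-a) := by
  have hL : AnalyticOnNhd ℂ (fun v : ℂ => ∫ t in Set.Ioi (0 : ℝ),
      (t : ℂ) ^ (a - 1) * Complex.exp (-(v * t))) {w | 0 < w.re} :=
    DifferentiableOn.analyticOnNhd (fun v hv => (differentiableAt_integral_cpow_mul_exp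
      (by simpa using ha) hv).differentiableWithinAt) (isOpen_re_gt 0)
  have hR : AnalyticOnNhd ℂ (fun v : ℂ => Complex.Gamma a * v ^ (-a)) {w | 0 < w.re} := by
    refine DifferentiableOn.analyticOnNhd (fun v hv => ?_) (isOpen_re_gt 0)
    exact (DifferentiableAt.const_mul
      (differentiableAt_id.cpow_const (Or.inl hv)) _).differentiableWithinAt
  refine hL.eqOn_of_preconnected_of_frequently_eq hR (isPreconnected_re_gt 0)
    (z₀ := 1) (by simp) ?_ hv
  have hreal : ∀ r : ℝ, 0 < r →
      ∫ t in Set.Ioi (0 : ℝ), (t : ℂ) ^ (a - 1) * Complex.exp (-((r : ℂ) * t))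
      = Complex.Gamma a * (r : ℂ) ^ (-a) := by
    intro r hr
    rw [Complex.integral_cpow_mul_exp_neg_mul_Ioi ha hr, mul_comm, one_div, Complex.cpow_neg,
      Complex.inv_cpow _ _ (by rw [Complex.arg_ofReal_of_nonneg hr.le]; exact Real.pi_pos.ne)]
  have hseq : Tendsto (fun n : ℕ => ((1 + 1 / ((n : ℝ) + 1) : ℝ) : ℂ)) atTop (𝓝[≠] 1) := by
    refine tendsto_nhdsWithin_iff.2 ⟨?_, Eventually.of_forall fun n => ?_⟩
    · have := (tendsto_one_div_add_atTop_nhds_zero_nat (𝕜 := ℝ)).const_add 1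
      rw [add_zero] at this
      exact_mod_cast (Complex.continuous_ofReal.tendsto 1).comp this
    · have : (1 + 1 / ((n : ℝ) + 1)) ≠ 1 := by
        have : 0 < 1 / ((n : ℝ) + 1) := by positivity
        linarith
      rw [Set.mem_compl_singleton_iff]
      exact_mod_cast this
  exact hseq.frequently (Frequently.of_forall fun n => hreal _ (by positivity))

/-! ### The ratio `1 - (1 - e⁻ᵗ) / t` -/

/-- `1 - (1 - e⁻ᵗ) / t`. -/
def deficitRatio (t : ℝ) : ℝ := 1 - (1 - Real.exp (-t)) / t

theorem deficitRatio_nonneg {t : ℝ} (ht : 0 < t) : 0 ≤ deficitRatio t := by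
  rw [deficitRatio, sub_nonneg, div_le_one ht]
  linarith [Real.add_one_le_exp (-t)]

/-- Equivalent to `t + 1 ≤ eᵗ`. This sharp form cancels the denominator `1 - e⁻ᵗ` at `z = 1`. -/
theorem deficitRatio_le {t : ℝ} (ht : 0 < t) : deficitRatio t ≤ 1 - Real.exp (-t) := by
  have h : Real.exp (-t) ≤ (1 - Real.exp (-t)) / t := by
    rw [le_div_iff₀ ht]
    have h1 := Real.add_one_le_exp t
    have h2 : Real.exp (-t) * Real.exp t = 1 := by rw [← Real.exp_add]; simp
    nlinarith [Real.exp_pos (-t)]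
  unfold deficitRatio; linarith

theorem deficitRatio_le_self {t : ℝ} (ht : 0 < t) : deficitRatio t ≤ t :=
  (deficitRatio_le ht).trans (by linarith [Real.add_one_le_exp (-t)])

theorem deficitRatio_le_one {t : ℝ} (ht : 0 < t) : deficitRatio t ≤ 1 :=
  (deficitRatio_le ht).trans (by linarith [Real.exp_pos (-t)])

theorem continuousOn_deficitRatio : ContinuousOn deficitRatio (Set.Ioi 0) := by
  unfold deficitRatio
  exact continuousOn_const.sub (ContinuousOn.div (by fun_prop) continuousOn_id fun t ht => ne_of_gt ht)

theorem measurable_deficitRatio : Measurable deficitRatio := by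
  unfold deficitRatio; fun_prop

/-! ### Mellin transforms of `e^{-vt} (1 - (1 - e⁻ᵗ)/t)` -/

theorem mellin_regular {f : ℝ → ℂ} {a b : ℝ} (ha : 0 < a) (hf : ContinuousOn f (Set.Ioi 0))
    (h1 : ∀ t, 0 < t → ‖f t‖ ≤ Real.exp (-a * t)) (h2 : ∀ t, 0 < t → ‖f t‖ ≤ t ^ (-b))
    {s : ℂ} (hs : b < s.re) : MellinConvergent f s ∧ DifferentiableAt ℂ (mellin f) s := by
  have hl : LocallyIntegrableOn f (Set.Ioi 0) := hf.locallyIntegrableOn measurableSet_Ioi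
  have ht : f =O[atTop] fun t => Real.exp (-a * t) := by
    refine Asymptotics.IsBigO.of_bound 1 ?_
    filter_upwards [eventually_gt_atTop 0] with t ht
    simpa [Real.abs_exp] using h1 t ht
  have hb : f =O[𝓝[>] 0] (· ^ (-b)) := by
    refine Asymptotics.IsBigO.of_bound 1 ?_
    filter_upwards [self_mem_nhdsWithin] with t ht
    have ht' : (0 : ℝ) < t := ht
    rw [Real.norm_of_nonneg (by positivity), one_mul]
    exact h2 t ht
  exact ⟨mellinConvergent_of_isBigO_rpow_exp ha hl ht hb hs,
    mellin_differentiableAt_of_isBigO_rpow_exp ha hl ht hb hs⟩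

theorem mellin_exp_mul_deficitRatio_regular {v s : ℂ} (hv : 0 < v.re) (hs : -1 < s.re) :
    MellinConvergent (fun t : ℝ => Complex.exp (-(v * t)) * deficitRatio t) s ∧
      DifferentiableAt ℂ (mellin fun t : ℝ => Complex.exp (-(v * t)) * deficitRatio t) s := by
  have hn : ∀ t : ℝ, 0 < t → ‖Complex.exp (-(v * t)) * deficitRatio t‖
      = Real.exp (-v.re * t) * deficitRatio t := fun t ht => by
    rw [norm_mul, norm_exp_neg_mul_ofReal, Complex.norm_real,
      Real.norm_of_nonneg (deficitRatio_nonneg ht)]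
  refine mellin_regular hv (b := -1) ?_ (fun t ht => ?_) (fun t ht => ?_) hs
  · exact ContinuousOn.mul (by fun_prop)
      (Complex.continuous_ofReal.comp_continuousOn continuousOn_deficitRatio)
  · rw [hn t ht]
    exact mul_le_of_le_one_right (Real.exp_pos _).le (deficitRatio_le_one ht)
  · rw [hn t ht, neg_neg, Real.rpow_one]
    exact (mul_le_of_le_one_left (deficitRatio_nonneg ht)
      (Real.exp_le_one_iff.2 (by nlinarith))).trans (deficitRatio_le_self ht)

theorem mellin_exp_mul_deficitRatio_of_one_lt {v s : ℂ} (hv : 0 < v.re) (hs : 1 < s.re) :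
    mellin (fun t : ℝ => Complex.exp (-(v * t)) * deficitRatio t) s
      = Complex.Gamma s * v ^ (-s)
        - Complex.Gamma (s - 1) * (v ^ (1 - s) - (v + 1) ^ (1 - s)) := by
  have hv' : 0 < (v + 1).re := by simp; linarith
  have hs1 : 0 < (s - 1).re := by simpa using hs
  have i1 := integrableOn_cpow_mul_exp_neg_mul (a := s - 1) (v := v)
    (by linarith) hv
  have i2 := integrableOn_cpow_mul_exp_neg_mul (a := s - 1 - 1) (v := v)
    (by simpa using hs1) hv
  have i3 := integrableOn_cpow_mul_exp_neg_mul (a := s - 1 - 1) (v := v + 1)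
    (by simpa using hs1) hv'
  have e1 := integral_cpow_mul_exp_neg_complex_mul (a := s) (by linarith) hv
  have e2 := integral_cpow_mul_exp_neg_complex_mul hs1 hv
  have e3 := integral_cpow_mul_exp_neg_complex_mul hs1 hv'
  rw [neg_sub] at e2 e3
  rw [mul_sub, ← e1, ← e2, ← e3, ← integral_sub i2 i3]
  refine Eq.trans ?_ (integral_sub i1 (i2.sub i3))
  rw [mellin]
  refine setIntegral_congr_fun measurableSet_Ioi fun t ht => ?_
  have ht' : (t : ℂ) ≠ 0 := by exact_mod_cast (ne_of_gt ht : t ≠ 0)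
  have hexp : Complex.exp (-((v + 1) * t)) = Complex.exp (-(v * t)) * Complex.exp (-t) := by
    rw [← Complex.exp_add]; ring_nf
  simp only [smul_eq_mul, deficitRatio, hexp]
  rw [Complex.cpow_sub (s - 1) 1 ht', Complex.cpow_one]
  push_cast
  field_simp

theorem mellin_exp_mul_deficitRatio {v s : ℂ} (hv : 0 < v.re) (hs : -1 < s.re) (hs0 : s ≠ 0) :
    (s - 1) * mellin (fun t : ℝ => Complex.exp (-(v * t)) * deficitRatio t) s
      = Complex.Gamma s * ((s - 1) * v ^ (-s) - (v ^ (1 - s) - (v + 1) ^ (1 - s))) := by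
  have hv0 : v ≠ 0 := fun h => by simp [h] at hv
  have hv1 : v + 1 ≠ 0 := fun h => by
    have := congrArg Complex.re h
    simp at this; linarith
  -- The formula for `Re s > 1` is continued to `Re s > -1`. The factor `s - 1` turns `Γ(s-1)` into
  -- `Γ(s)`, and the extra `s` turns that into `Γ(s+1)`, which has no pole there; `s` is cancelled
  -- at the end.
  have hL : AnalyticOnNhd ℂ (fun s => s * ((s - 1) *
      mellin (fun t : ℝ => Complex.exp (-(v * t)) * deficitRatio t) s)) {w | -1 < w.re} := by
    refine DifferentiableOn.analyticOnNhd (fun s hs => ?_) (isOpen_re_gt _)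
    have := (mellin_exp_mul_deficitRatio_regular hv hs).2
    exact DifferentiableAt.differentiableWithinAt (by fun_prop)
  have hR : AnalyticOnNhd ℂ (fun s => Complex.Gamma (s + 1) *
      ((s - 1) * v ^ (-s) - (v ^ (1 - s) - (v + 1) ^ (1 - s)))) {w | -1 < w.re} := by
    refine DifferentiableOn.analyticOnNhd (fun s hs => ?_) (isOpen_re_gt _)
    have hG : DifferentiableAt ℂ (fun s => Complex.Gamma (s + 1)) s := by
      refine DifferentiableAt.comp s (Complex.differentiableAt_Gamma _ fun n h => ?_) (by fun_prop)
      have h := congrArg Complex.re h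
      have hs' : -1 < s.re := hs
      simp at h
      have : (0 : ℝ) ≤ n := n.cast_nonneg
      linarith
    have h1 : DifferentiableAt ℂ (fun s : ℂ => v ^ (-s)) s :=
      DifferentiableAt.const_cpow (by fun_prop) (Or.inl hv0)
    have h2 : DifferentiableAt ℂ (fun s : ℂ => v ^ (1 - s)) s :=
      DifferentiableAt.const_cpow (by fun_prop) (Or.inl hv0)
    have h3 : DifferentiableAt ℂ (fun s : ℂ => (v + 1) ^ (1 - s)) s :=
      DifferentiableAt.const_cpow (by fun_prop) (Or.inl hv1)
    exact DifferentiableAt.differentiableWithinAt (by fun_prop)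
  have key := hL.eqOn_of_preconnected_of_eventuallyEq hR (isPreconnected_re_gt _) (z₀ := 2)
    (by norm_num) ?_ hs
  · simp only [Complex.Gamma_add_one s hs0, mul_assoc] at key
    exact mul_left_cancel₀ hs0 key
  · filter_upwards [(isOpen_re_gt 1).mem_nhds (by norm_num : (1 : ℝ) < (2 : ℂ).re)] with w hw
    have hw' : 1 < w.re := hw
    have hw0 : w ≠ 0 := fun h => by rw [h] at hw'; simp at hw'; linarith
    have hw1 : w - 1 ≠ 0 := fun h => by
      rw [sub_eq_zero.1 h] at hw'; simp at hw'
    have := Complex.Gamma_add_one (w - 1) hw1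
    rw [sub_add_cancel] at this
    rw [mellin_exp_mul_deficitRatio_of_one_lt hv hw, Complex.Gamma_add_one w hw0, this]
    ring

/-! ### Uniqueness of continuation values -/

theorem continuationValue_eq {f : ℂ → ℂ} {V : Set ℂ} {𝒰 : Set (Set ℂ)} {p v : ℂ}
    (hv : IsContinuationValue f V 𝒰 p v) (huniq : ∀ w, IsContinuationValue f V 𝒰 p w → w = v) :
    continuationValue f V 𝒰 p = v := by
  have h : ∃ v, IsContinuationValue f V 𝒰 p v := ⟨v, hv⟩
  rw [continuationValue, dif_pos h]
  exact huniq _ h.choose_spec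

/-- For `c < 1` it is a union of four convex pieces, right of, above, below and left of the point
`1`, glued at explicit common points; for `c ≥ 1` nothing is removed. -/
theorem isPreconnected_puncturedHalfPlane (c : ℝ) : IsPreconnected (puncturedHalfPlane c) := by
  rcases le_or_gt 1 c with hc | hc
  · have : puncturedHalfPlane c = {w : ℂ | c < w.re} := by
      ext w
      refine ⟨fun h => h.1, fun h => ⟨h, fun h1 => ?_⟩⟩
      have h : c < w.re := h
      rw [h1] at h
      simp at h
      linarith
    rw [this]
    exact isPreconnected_re_gt c
  · have hre : Convex ℝ {w : ℂ | c < w.re} := convex_halfSpace_re_gt c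
    have hA : IsPreconnected {w : ℂ | 1 < w.re} := isPreconnected_re_gt 1
    have hB : IsPreconnected ({w : ℂ | c < w.re} ∩ {w | 0 < w.im}) :=
      (hre.inter (convex_halfSpace_im_gt 0)).isPreconnected
    have hC : IsPreconnected ({w : ℂ | c < w.re} ∩ {w | w.im < 0}) :=
      (hre.inter (convex_halfSpace_im_lt 0)).isPreconnected
    have hD : IsPreconnected ({w : ℂ | c < w.re} ∩ {w | w.re < 1}) :=
      (hre.inter (convex_halfSpace_re_lt 1)).isPreconnected
    have hAB := IsPreconnected.union (⟨2, 1⟩ : ℂ) (by norm_num)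
      (by simp only [Set.mem_inter_iff, Set.mem_ofPred_eq]; constructor <;> linarith) hA hB
    have hABC := IsPreconnected.union (⟨2, -1⟩ : ℂ) (Or.inl (by norm_num))
      (by simp only [Set.mem_inter_iff, Set.mem_ofPred_eq]; constructor <;> linarith) hAB hC
    have hABCD := IsPreconnected.union (⟨(1 + c) / 2, 1⟩ : ℂ)
      (Or.inl (Or.inr (by
        simp only [Set.mem_inter_iff, Set.mem_ofPred_eq]; constructor <;> linarith)))
      (by simp only [Set.mem_inter_iff, Set.mem_ofPred_eq]; constructor <;> linarith) hABC hD
    convert hABCD using 1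
    ext w
    simp only [puncturedHalfPlane, Set.mem_ofPred_eq, Set.mem_union, Set.mem_inter_iff]
    constructor
    · rintro ⟨h1, h2⟩
      rcases lt_trichotomy w.im 0 with h | h | h
      · simp [h1, h]
      · rcases lt_trichotomy w.re 1 with h' | h' | h'
        · simp [h1, h']
        · exact absurd (Complex.ext (by simp [h']) (by simp [h])) h2
        · simp [h']
      · simp [h1, h]
    · rintro (((h | ⟨h, h'⟩) | ⟨h, h'⟩) | ⟨h, h'⟩)
      · exact ⟨hc.trans h, fun e => by simp [e] at h⟩
      · exact ⟨h, fun e => by simp [e] at h'⟩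
      · exact ⟨h, fun e => by simp [e] at h'⟩
      · exact ⟨h, fun e => by simp [e] at h'⟩

theorem continuationValue_range_puncturedHalfPlane {f g : ℂ → ℂ} {c : ℝ} {p : ℂ}
    (hp : p ∈ puncturedHalfPlane c) (hg : AnalyticOnNhd ℂ g (puncturedHalfPlane c))
    (hfg : ∀ w : ℂ, 1 < w.re → c < w.re → g w = f w) :
    continuationValue f {w | 1 < w.re} (Set.range puncturedHalfPlane) p = g p := by
  refine continuationValue_eq ⟨_, ⟨c, rfl⟩, hp, g, ⟨hg, fun w hw => hfg w hw.1 hw.2.1⟩, rfl⟩ ?_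
  rintro v ⟨_, ⟨c', rfl⟩, hp', g', ⟨hg', hfg'⟩, rfl⟩
  have hsub : ∀ d, d ≤ max c c' → puncturedHalfPlane (max c c') ⊆ puncturedHalfPlane d :=
    fun d hd w hw => ⟨hd.trans_lt hw.1, hw.2⟩
  -- A real point in both half-planes and in `Re w > 1`, near which both continuations equal `f`.
  set x : ℝ := max 1 (max c c') + 1 with hx
  have hx1 : 1 < x := by rw [hx]; linarith [le_max_left 1 (max c c')]
  have hx2 : max c c' < x := by rw [hx]; linarith [le_max_right 1 (max c c')]
  refine (hg'.mono (hsub c' (le_max_right _ _))).eqOn_of_preconnected_of_eventuallyEq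
    (hg.mono (hsub c (le_max_left _ _))) (isPreconnected_puncturedHalfPlane _) (z₀ := (x : ℂ))
    ⟨by simpa using hx2, fun h => ?_⟩ ?_ ⟨max_lt hp.1 hp'.1, hp.2⟩
  · have := congrArg Complex.re h
    simp at this
    linarith
  · filter_upwards [(isOpen_re_gt 1).mem_nhds (by simpa using hx1 : (1 : ℝ) < (x : ℂ).re),
      (isOpen_re_gt (max c c')).mem_nhds (by simpa using hx2 : max c c' < (x : ℂ).re)] with w h1 h2
    have h1 : 1 < w.re := h1
    have h2 : max c c' < w.re := h2
    rw [hfg w h1 ((le_max_left _ _).trans_lt h2)]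
    exact hfg' ⟨h1, (le_max_right _ _).trans_lt h2, fun e => by simp [e] at h1⟩

/-- `g` extends the Lerch series in `z` to the cut plane. -/
def IsLerchExtension (s u : ℂ) (g : ℂ → ℂ) : Prop :=
  AnalyticOnNhd ℂ g cutPlane ∧
    ∀ z ∈ Metric.ball (0 : ℂ) 1, HasSum (fun n : ℕ => z ^ n / (u + (n : ℂ)) ^ s) (g z)

theorem IsLerchExtension.lerchPhi_eq {s u z : ℂ} {g : ℂ → ℂ} (hg : IsLerchExtension s u g)
    (hz : z ∈ cutPlane) : lerchPhi z s u = g z := by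
  have hz1 : z ≠ 1 := fun h => one_notMem_cutPlane (h ▸ hz)
  rw [lerchPhi, if_neg hz1]
  refine continuationValue_eq
    ⟨cutPlane, rfl, hz, g, ⟨hg.1, fun w hw => (hg.2 w hw.1).tsum_eq.symm⟩, rfl⟩ ?_
  rintro v ⟨_, rfl, -, g', ⟨hg', hfg'⟩, rfl⟩
  refine hg'.eqOn_of_preconnected_of_eventuallyEq hg.1 isPreconnected_cutPlane
    (ball_subset_cutPlane (by simp : (0 : ℂ) ∈ Metric.ball 0 1)) ?_ hz
  filter_upwards [Metric.ball_mem_nhds (0 : ℂ) zero_lt_one] with w hw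
  rw [hfg' ⟨hw, ball_subset_cutPlane hw⟩]
  exact (hg.2 w hw).tsum_eq

/-! ### Existence of the continuation in `z` -/

theorem re_add_natCast_pos {u : ℂ} (hu : 0 < u.re) (n : ℕ) : 0 < (u + n).re := by
  simp; positivity

theorem add_natCast_ne_zero {u : ℂ} (hu : 0 < u.re) (n : ℕ) : u + n ≠ 0 := fun h => by
  have := re_add_natCast_pos hu n
  simp [h] at this

theorem integral_exp_mul_cpow_mul_exp {s u : ℂ} (hs : 0 < s.re) (hu : 0 < u.re) (n : ℕ) :
    ∫ t in Set.Ioi (0 : ℝ), Complex.exp (-(n * t)) * ((t : ℂ) ^ (s - 1) * Complex.exp (-(u * t)))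
      = Complex.Gamma s * (u + n) ^ (-s) := by
  rw [← integral_cpow_mul_exp_neg_complex_mul hs (re_add_natCast_pos hu n)]
  refine integral_congr_ae (ae_of_all _ fun t => ?_)
  have : Complex.exp (-((u + n) * t)) = Complex.exp (-(n * t)) * Complex.exp (-(u * t)) := by
    rw [← Complex.exp_add]; ring_nf
  simp only [this]
  ring

theorem isLerchExtension_of_re_pos {s u : ℂ} (hs : 0 < s.re) (hu : 0 < u.re) :
    IsLerchExtension s u fun z => (Complex.Gamma s)⁻¹ * ∫ t in Set.Ioi (0 : ℝ),
      ((t : ℂ) ^ (s - 1) * Complex.exp (-(u * t))) / (1 - z * Real.exp (-t)) := by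
  have hi := integrableOn_cpow_mul_exp_neg_mul (a := s - 1) (by simpa using hs) hu
  refine ⟨analyticOnNhd_const.mul (analyticOnNhd_integral_div_one_sub hi), fun z hz => ?_⟩
  have := (hasSum_integral_div_one_sub_of_norm_lt_one (by simpa using hz) hi).mul_left
    (Complex.Gamma s)⁻¹
  refine this.congr_fun fun n => ?_
  rw [integral_exp_mul_cpow_mul_exp hs hu, Complex.cpow_neg]
  have := Complex.Gamma_ne_zero_of_re_pos hs
  field_simp

/-- The operator `u + z d/dz` multiplies the `n`-th term by `u + n`, so it lowers `s` by one.
Iterating it from `Re s > 0` reaches every `s`. -/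
theorem IsLerchExtension.sub_one {s u : ℂ} (hu : 0 < u.re) {g : ℂ → ℂ}
    (hg : IsLerchExtension s u g) :
    IsLerchExtension (s - 1) u fun z => u * g z + z * deriv g z := by
  refine ⟨(analyticOnNhd_const.mul hg.1).add (analyticOnNhd_id.mul hg.1.deriv), fun z hz => ?_⟩
  have hz1 : ‖z‖ < 1 := by simpa using hz
  -- The convergent series at `r` majorizes the terms on the ball of radius `r`, which justifies
  -- termwise differentiation at `z`.
  obtain ⟨r, hzr, hr1⟩ := exists_between hz1
  have hr0 : 0 ≤ r := (norm_nonneg z).trans hzr.le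
  have hrball : (r : ℂ) ∈ Metric.ball (0 : ℂ) 1 := by simpa [abs_of_nonneg hr0] using hr1
  have hd := Complex.hasSum_deriv_of_summable_norm (U := Metric.ball (0 : ℂ) r)
    (F := fun (n : ℕ) (w : ℂ) => w ^ n / (u + (n : ℂ)) ^ s) (hg.2 r hrball).summable.norm
    (fun n => by fun_prop) Metric.isOpen_ball (fun n w hw => ?_) (by simpa using hzr)
  · have hev : (fun w : ℂ => ∑' n : ℕ, w ^ n / (u + (n : ℂ)) ^ s) =ᶠ[𝓝 z] g := by
      filter_upwards [Metric.isOpen_ball.mem_nhds hz] with w hw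
      exact (hg.2 w hw).tsum_eq
    rw [hev.deriv_eq] at hd
    refine (((hg.2 z hz).mul_left u).add (hd.mul_left z)).congr_fun fun n => ?_
    have hne := add_natCast_ne_zero hu n
    have hpow : (u + n) ^ s ≠ 0 := by simp [Complex.cpow_eq_zero_iff, hne]
    have hder : z * deriv (fun w : ℂ => w ^ n / (u + (n : ℂ)) ^ s) z
        = n * z ^ n / (u + (n : ℂ)) ^ s := by
      rw [deriv_div_const, deriv_pow_field]
      rcases n with _ | n
      · simp
      · simp only [Nat.add_sub_cancel, pow_succ]; ring
    rw [hder, Complex.cpow_sub _ _ hne, Complex.cpow_one]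
    field_simp
  · have hw : ‖w‖ < r := by simpa using hw
    rw [norm_div, norm_div, norm_pow, norm_pow, Complex.norm_real, Real.norm_of_nonneg hr0]
    gcongr

theorem exists_isLerchExtension (s : ℂ) {u : ℂ} (hu : 0 < u.re) :
    ∃ g, IsLerchExtension s u g := by
  have key : ∀ (k : ℕ) (s : ℂ), -(k : ℝ) < s.re → ∃ g, IsLerchExtension s u g := by
    intro k
    induction k with
    | zero => exact fun s hs => ⟨_, isLerchExtension_of_re_pos (by simpa using hs) hu⟩
    | succ k ih =>
      intro s hs
      push_cast at hs
      obtain ⟨g, hg⟩ := ih (s + 1) (by simp; linarith)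
      have := hg.sub_one hu
      rw [add_sub_cancel_right] at this
      exact ⟨_, this⟩
  obtain ⟨k, hk⟩ := exists_nat_gt (-s.re)
  exact key k s (by linarith)

/-! ### The integral over the half-line -/

/-- `∫₀^∞ t^{s-1} e^{-ut} (1 - (1 - e⁻ᵗ)/t) / (1 - z e⁻ᵗ) dt`. -/
def deficitIntegral (z s u : ℂ) : ℂ :=
  ∫ t in Set.Ioi (0 : ℝ), ((t : ℂ) ^ (s - 1) * (Complex.exp (-(u * t)) * deficitRatio t))
    / (1 - z * Real.exp (-t))

theorem integrableOn_deficit {s u : ℂ} (hs : -1 < s.re) (hu : 0 < u.re) :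
    IntegrableOn (fun t : ℝ => (t : ℂ) ^ (s - 1) * (Complex.exp (-(u * t)) * deficitRatio t))
      (Set.Ioi 0) :=
  (mellin_exp_mul_deficitRatio_regular hu hs).1

theorem deficitIntegral_eq {s u : ℂ} (hu : 0 < u.re) (hs : -1 < s.re) (hs0 : s ≠ 0)
    {z : ℂ} (hz : z ∈ cutPlane) :
    z * (s - 1) * deficitIntegral z s u = Complex.Gamma s * (z * (s - 1) * lerchPhi z s u
      + (1 - z) * lerchPhi z (s - 1) u - u ^ (1 - s)) := by
  obtain ⟨a, ha⟩ := exists_isLerchExtension s hu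
  obtain ⟨b, hb⟩ := exists_isLerchExtension (s - 1) hu
  rw [ha.lerchPhi_eq hz, hb.lerchPhi_eq hz]
  have hi := integrableOn_deficit hs hu
  have hL : AnalyticOnNhd ℂ (fun z => z * (s - 1) * deficitIntegral z s u) cutPlane :=
    (analyticOnNhd_id.mul analyticOnNhd_const).mul (analyticOnNhd_integral_div_one_sub hi)
  have hR : AnalyticOnNhd ℂ (fun z => Complex.Gamma s * (z * (s - 1) * a z
      + (1 - z) * b z - u ^ (1 - s))) cutPlane :=
    analyticOnNhd_const.mul (((((analyticOnNhd_id.mul analyticOnNhd_const).mul ha.1)).add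
      ((analyticOnNhd_const.sub analyticOnNhd_id).mul hb.1)).sub analyticOnNhd_const)
  refine hL.eqOn_of_preconnected_of_eventuallyEq hR isPreconnected_cutPlane
    (ball_subset_cutPlane (by simp : (0 : ℂ) ∈ Metric.ball 0 1)) ?_ hz
  filter_upwards [Metric.ball_mem_nhds (0 : ℂ) zero_lt_one] with z hz
  have h1 := (hasSum_integral_div_one_sub_of_norm_lt_one (by simpa using hz) hi).mul_left
    (z * (s - 1))
  have hA := ha.2 z hz
  have hB := hb.2 z hz
  -- Dropping the `n = 0` term gives the sum of `z^{n+1} (u+n+1)^{1-s}`; this is where `u^{1-s}`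
  -- comes from.
  have hB1 := (hasSum_nat_add_iff' 1).2 hB
  simp only [Finset.range_one, Finset.sum_singleton, pow_zero, Nat.cast_zero, add_zero] at hB1
  have h2 := ((hA.mul_left (z * (s - 1))).sub ((hB.mul_left z).sub hB1)).mul_left (Complex.Gamma s)
  have h3 := h1.unique (h2.congr_fun fun n => ?_)
  · rw [deficitIntegral, h3, one_div, ← Complex.cpow_neg, neg_sub]
    ring
  · have hv := re_add_natCast_pos hu n
    have hK := mellin_exp_mul_deficitRatio hv hs hs0
    have hM : ∫ t in Set.Ioi (0 : ℝ), Complex.exp (-(n * t)) *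
        ((t : ℂ) ^ (s - 1) * (Complex.exp (-(u * t)) * deficitRatio t))
        = mellin (fun t : ℝ => Complex.exp (-((u + n) * t)) * deficitRatio t) s := by
      rw [mellin]
      refine integral_congr_ae (ae_of_all _ fun t => ?_)
      have : Complex.exp (-((u + n) * t)) = Complex.exp (-(n * t)) * Complex.exp (-(u * t)) := by
        rw [← Complex.exp_add]; ring_nf
      simp only [this, smul_eq_mul]
      ring
    have e1 : (u + (n : ℂ)) ^ (1 - s) = 1 / (u + (n : ℂ)) ^ (s - 1) := by
      rw [one_div, ← Complex.cpow_neg, neg_sub]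
    have e2 : (u + (n : ℂ) + 1) ^ (1 - s) = 1 / (u + ((n + 1 : ℕ) : ℂ)) ^ (s - 1) := by
      rw [one_div, ← Complex.cpow_neg, neg_sub]
      push_cast; rw [add_assoc]
    rw [hM]
    calc _ = z ^ n * z * ((s - 1) *
          mellin (fun t : ℝ => Complex.exp (-((u + n) * t)) * deficitRatio t) s) := by ring
      _ = _ := by
        rw [hK, e1, e2, Complex.cpow_neg, pow_succ]
        ring

theorem continuousAt_deficitIntegral {z s u : ℂ} (hu : 0 < u.re) (hs : -1 < s.re)
    (hz : z ∈ cutPlane) :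
    ContinuousAt (fun p : ℂ × ℂ => deficitIntegral p.1 p.2 u) (z, s) := by
  obtain ⟨c, hc, hev⟩ := eventually_le_norm_one_sub_mul hz
  obtain ⟨a, ha1, has⟩ := exists_between hs
  have hev1 : ∀ᶠ p : ℂ × ℂ in 𝓝 (z, s), ∀ y ∈ Set.Icc (0 : ℝ) 1, c ≤ ‖1 - p.1 * y‖ :=
    (continuous_fst.tendsto (z, s)).eventually hev
  have hev2 : ∀ᶠ p : ℂ × ℂ in 𝓝 (z, s), a < p.2.re :=
    (continuous_snd.tendsto (z, s)).eventually ((isOpen_re_gt a).mem_nhds has)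
  have hev3 : ∀ᶠ p : ℂ × ℂ in 𝓝 (z, s), p.2.re < s.re + 1 :=
    (continuous_snd.tendsto (z, s)).eventually
      ((isOpen_lt Complex.continuous_re continuous_const).mem_nhds (lt_add_one s.re))
  have hmr := measurable_deficitRatio
  refine continuousAt_of_dominated (bound := fun t => (t ^ a * Real.exp (-u.re * t)
    + t ^ (s.re + 1) * Real.exp (-u.re * t)) / c) (Eventually.of_forall fun p => ?_) ?_ ?_ ?_
  · exact (by fun_prop : Measurable _).aestronglyMeasurable
  · filter_upwards [hev1, hev2, hev3] with p h1 h2 h3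
    refine (ae_restrict_iff' measurableSet_Ioi).2 (ae_of_all _ fun t ht => ?_)
    have ht' : (0 : ℝ) < t := ht
    have hden := h1 _ (exp_neg_mem_Icc ht)
    rw [norm_div, norm_mul, norm_mul, norm_exp_neg_mul_ofReal, Complex.norm_real,
      Real.norm_of_nonneg (deficitRatio_nonneg ht), Complex.norm_cpow_eq_rpow_re_of_pos ht]
    have hpow : t ^ (p.2 - 1).re * deficitRatio t ≤ t ^ p.2.re := by
      have : t ^ p.2.re = t ^ (p.2 - 1).re * t := by
        rw [← Real.rpow_add_one ht'.ne']; simp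
      rw [this]
      have := deficitRatio_le_self ht
      gcongr
    -- The exponent varies between `a > -1` and `Re s + 1`: the first power dominates for `t ≤ 1`,
    -- the second for `t ≥ 1`.
    have hpow2 : t ^ p.2.re ≤ t ^ a + t ^ (s.re + 1) := by
      rcases le_total t 1 with h | h
      · have := Real.rpow_le_rpow_of_exponent_ge ht' h h2.le
        have : 0 ≤ t ^ (s.re + 1) := by positivity
        linarith
      · have := Real.rpow_le_rpow_of_exponent_le h h3.le
        have : 0 ≤ t ^ a := by positivity
        linarith
    rw [← add_mul]
    calc _ = (t ^ (p.2 - 1).re * deficitRatio t) * Real.exp (-u.re * t)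
          / ‖1 - p.1 * (Real.exp (-t) : ℂ)‖ := by ring
      _ ≤ _ := by
        gcongr
        exact hpow.trans hpow2
  · exact ((integrableOn_rpow_mul_exp_neg_mul ha1 hu).add
      (integrableOn_rpow_mul_exp_neg_mul (by linarith) hu)).div_const _
  · refine (ae_restrict_iff' measurableSet_Ioi).2 (ae_of_all _ fun t ht => ?_)
    have ht' : (t : ℂ) ≠ 0 := by exact_mod_cast (ne_of_gt ht : t ≠ 0)
    have hne : 1 - z * (Real.exp (-t) : ℂ) ≠ 0 :=
      Complex.slitPlane_ne_zero (one_sub_mul_mem_slitPlane hz (exp_neg_mem_Icc ht))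
    refine ContinuousAt.div (ContinuousAt.mul ?_ continuousAt_const) (by fun_prop) hne
    exact ContinuousAt.const_cpow (by fun_prop) (Or.inl ht')

/-! ### The case `z = 1` -/

theorem mellin_exp_mul_deficitRatio_div_regular {v s : ℂ} (hv : 0 < v.re) (hs : 0 < s.re) :
    MellinConvergent (fun t : ℝ => Complex.exp (-(v * t)) * deficitRatio t
        / (1 - Real.exp (-t))) s ∧
      DifferentiableAt ℂ (mellin fun t : ℝ => Complex.exp (-(v * t)) * deficitRatio t
        / (1 - Real.exp (-t))) s := by
  have hpos : ∀ t : ℝ, 0 < t → 0 < 1 - Real.exp (-t) := fun t ht =>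
    sub_pos.2 (Real.exp_lt_one_iff.2 (by linarith))
  have hn : ∀ t : ℝ, 0 < t → ‖Complex.exp (-(v * t)) * deficitRatio t / (1 - Real.exp (-t))‖
      ≤ Real.exp (-v.re * t) := fun t ht => by
    rw [show (1 : ℂ) - Real.exp (-t) = ((1 - Real.exp (-t) : ℝ) : ℂ) by push_cast; rfl,
      norm_div, norm_mul, norm_exp_neg_mul_ofReal, Complex.norm_real, Complex.norm_real,
      Real.norm_of_nonneg (deficitRatio_nonneg ht), Real.norm_of_nonneg (hpos t ht).le,
      mul_div_assoc]
    exact mul_le_of_le_one_right (Real.exp_pos _).le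
      ((div_le_one (hpos t ht)).2 (deficitRatio_le ht))
  refine mellin_regular hv (b := 0) ?_ hn (fun t ht => ?_) hs
  · refine ContinuousOn.div (ContinuousOn.mul (by fun_prop)
      (Complex.continuous_ofReal.comp_continuousOn continuousOn_deficitRatio)) (by fun_prop)
      fun t ht => ?_
    exact_mod_cast (hpos t ht).ne'
  · refine (hn t ht).trans ?_
    rw [neg_zero, Real.rpow_zero]
    exact Real.exp_le_one_iff.2 (by nlinarith)

theorem deficitIntegral_one (s u : ℂ) :
    deficitIntegral 1 s u = mellin (fun t : ℝ => Complex.exp (-(u * t)) * deficitRatio t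
        / (1 - Real.exp (-t))) s := by
  rw [deficitIntegral, mellin]
  refine integral_congr_ae (ae_of_all _ fun t => ?_)
  simp only [smul_eq_mul, one_mul]
  ring

/-- Split `1/(1 - e⁻ᵗ)` as `r(t)/(1 - e⁻ᵗ) + 1/t`. The singular part `1/t` integrates to `Γ(s-1)
u^{1-s}`, which carries the pole of `Φ(1,s,u)` at `s = 1`. -/
theorem hasSum_lerchSeries_one {s u : ℂ} (hu : 0 < u.re) (hs : 1 < s.re) :
    HasSum (fun n : ℕ => Complex.Gamma s * (u + n) ^ (-s))
      (deficitIntegral 1 s u + Complex.Gamma (s - 1) * u ^ (1 - s)) := by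
  have hs1 : 0 < (s - 1).re := by simpa using hs
  have hi := integrableOn_cpow_mul_exp_neg_mul (a := s - 1) (v := u) (by linarith) hu
  have hi2 := integrableOn_cpow_mul_exp_neg_mul (a := s - 1 - 1) (v := u) (by simpa using hs1) hu
  have hpos : ∀ t : ℝ, 0 < t → 0 < 1 - Real.exp (-t) := fun t ht =>
    sub_pos.2 (Real.exp_lt_one_iff.2 (by linarith))
  have hsplit : ∀ t ∈ Set.Ioi (0 : ℝ),
      ((t : ℂ) ^ (s - 1) * Complex.exp (-(u * t))) / (1 - 1 * Real.exp (-t))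
      = (t : ℂ) ^ (s - 1) • (Complex.exp (-(u * t)) * deficitRatio t / (1 - Real.exp (-t)))
        + (t : ℂ) ^ (s - 1 - 1) * Complex.exp (-(u * t)) := by
    intro t ht
    have ht' : (t : ℂ) ≠ 0 := by exact_mod_cast (ne_of_gt ht : t ≠ 0)
    have hne : 1 - (Real.exp (-t) : ℂ) ≠ 0 := by exact_mod_cast (hpos t ht).ne'
    rw [Complex.cpow_sub (s - 1) 1 ht', Complex.cpow_one, deficitRatio, one_mul, smul_eq_mul]
    push_cast at hne ⊢
    field_simp
    ring
  have hconv := (mellin_exp_mul_deficitRatio_div_regular hu (by linarith : 0 < s.re)).1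
  have hint : IntegrableOn (fun t : ℝ => ((t : ℂ) ^ (s - 1) * Complex.exp (-(u * t)))
      / (1 - 1 * Real.exp (-t))) (Set.Ioi 0) :=
    IntegrableOn.congr_fun (Integrable.add hconv hi2) (fun t ht => (hsplit t ht).symm)
      measurableSet_Ioi
  have key := hasSum_integral_div_one_sub (z := 1) (by simp) hi.aestronglyMeasurable
    (IntegrableOn.congr_fun hint.norm (fun t ht => ?_) measurableSet_Ioi)
  · rw [setIntegral_congr_fun measurableSet_Ioi hsplit, integral_add hconv hi2,
      integral_cpow_mul_exp_neg_complex_mul hs1 hu, neg_sub] at key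
    rw [deficitIntegral_one]
    refine key.congr_fun fun n => ?_
    rw [one_pow, one_mul, integral_exp_mul_cpow_mul_exp (by linarith) hu]
  · rw [norm_div, norm_one, one_mul, one_mul,
      show (1 : ℂ) - Real.exp (-t) = ((1 - Real.exp (-t) : ℝ) : ℂ) by push_cast; rfl,
      Complex.norm_real, Real.norm_of_nonneg (hpos t ht).le]

theorem lerchPhi_one {s u : ℂ} (hu : 0 < u.re) (hs : 0 < s.re) (hs1 : s ≠ 1) :
    lerchPhi 1 s u = u ^ (1 - s) / (s - 1) + (Complex.Gamma s)⁻¹ * deficitIntegral 1 s u := by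
  rw [lerchPhi, if_pos rfl]
  have hu0 : u ≠ 0 := fun h => by simp [h] at hu
  have hopen : IsOpen (puncturedHalfPlane 0) := (isOpen_re_gt 0).inter isOpen_ne
  refine continuationValue_range_puncturedHalfPlane (c := 0)
    (g := fun s => u ^ (1 - s) / (s - 1) + (Complex.Gamma s)⁻¹ * deficitIntegral 1 s u)
    ⟨hs, hs1⟩ ?_ fun w hw _ => ?_
  · refine DifferentiableOn.analyticOnNhd (fun w hw => ?_) hopen
    have h1 : DifferentiableAt ℂ (fun s : ℂ => u ^ (1 - s)) w :=
      DifferentiableAt.const_cpow (by fun_prop) (Or.inl hu0)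
    have h2 : DifferentiableAt ℂ (fun s : ℂ => (Complex.Gamma s)⁻¹) w :=
      Complex.differentiable_one_div_Gamma w
    have h4 : DifferentiableAt ℂ (fun s : ℂ => u ^ (1 - s) / (s - 1)) w :=
      h1.fun_div (by fun_prop) (sub_ne_zero.2 hw.2)
    have h3 : DifferentiableAt ℂ (fun s => deficitIntegral 1 s u) w := by
      simp_rw [deficitIntegral_one]
      exact (mellin_exp_mul_deficitRatio_div_regular hu hw.1).2
    exact (h4.fun_add (h2.fun_mul h3)).differentiableWithinAt
  · have hG : Complex.Gamma w ≠ 0 := Complex.Gamma_ne_zero_of_re_pos (by linarith)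
    have hw1 : w - 1 ≠ 0 := fun h => by
      rw [sub_eq_zero.1 h] at hw; simp at hw
    have hGw := Complex.Gamma_add_one (w - 1) hw1
    rw [sub_add_cancel] at hGw
    have := (hasSum_lerchSeries_one hu hw).mul_left (Complex.Gamma w)⁻¹
    have hterm : (fun n : ℕ => (Complex.Gamma w)⁻¹ * (Complex.Gamma w * (u + n) ^ (-w)))
        = fun n : ℕ => (1 : ℂ) ^ n / (u + (n : ℂ)) ^ w := by
      ext n
      rw [inv_mul_cancel_left₀ hG, Complex.cpow_neg, one_pow, one_div]
    rw [hterm] at this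
    rw [lerchSeries, this.tsum_eq, mul_add, add_comm]
    congr 1
    have hG' : Complex.Gamma (w - 1) ≠ 0 := fun h => hG (by rw [hGw, h, mul_zero])
    rw [hGw]
    field_simp

theorem continuousAt_deficitIntegral_one {s u : ℂ} (hu : 0 < u.re) (hs : 0 < s.re) :
    ContinuousAt (fun s => deficitIntegral 1 s u) s := by
  simp_rw [deficitIntegral_one]
  exact (mellin_exp_mul_deficitRatio_div_regular hu hs).2.continuousAt

/-! ### The cube integral and the closed form -/

theorem integrableOn_deficitIntegral {z s u : ℂ} (hu : 0 < u.re)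
    (h : (z ∈ cutPlane ∧ -1 < s.re) ∨ (z = 1 ∧ 0 < s.re)) :
    IntegrableOn (fun t : ℝ => ((t : ℂ) ^ (s - 1) * (Complex.exp (-(u * t)) * deficitRatio t))
      / (1 - z * Real.exp (-t))) (Set.Ioi 0) := by
  rcases h with ⟨hz, hs⟩ | ⟨rfl, hs⟩
  · obtain ⟨c, hc, hev⟩ := eventually_le_norm_one_sub_mul hz
    have hi := integrableOn_deficit hs hu
    refine Integrable.mono' (hi.norm.div_const c)
      (hi.aestronglyMeasurable.div₀ (by fun_prop : Continuous _).aestronglyMeasurable) ?_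
    refine (ae_restrict_iff' measurableSet_Ioi).2 (ae_of_all _ fun t ht => ?_)
    rw [norm_div]
    have := hev.self_of_nhds _ (exp_neg_mem_Icc ht)
    gcongr
  · refine (mellin_exp_mul_deficitRatio_div_regular hu hs).1.congr_fun (fun t _ => ?_)
      measurableSet_Ioi
    simp only [smul_eq_mul, one_mul]
    ring

theorem deficitWeight_succ (k : ℕ) {t : ℝ} (ht : 0 < t) :
    deficitWeight (k + 1) t = t ^ (k + 1) * deficitRatio t / k.factorial := by
  rw [deficitWeight, deficitRatio, Nat.factorial_succ]
  have : (k.factorial : ℝ) ≠ 0 := by positivity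
  push_cast
  field_simp
  ring

/-- `e^{-(u-1)t} tˢ / (1 - z e⁻ᵗ)`, the integrand without its weight, in terms of
`t = -log (x₁ ⋯ x_m)`. -/
def logKernel (z s u : ℂ) (t : ℝ) : ℂ :=
  Complex.exp (-((u - 1) * t)) * (t : ℂ) ^ s / (1 - z * Real.exp (-t))

theorem measurable_logKernel (z s u : ℂ) : Measurable (logKernel z s u) := by
  unfold logKernel; fun_prop

theorem cubeIntegrand_eq {m : ℕ} (z s u : ℂ) {x : Fin (m + 1) → ℝ} (hx : x ∈ openCube (m + 1)) :
    cubeIntegrand (m + 1) z s u x = partialProdDeficit x • logKernel z s u (-Real.log (∏ j, x j)) := by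
  have hp := (prod_mem_Ioo_of_mem_openCube hx).1
  have hp' : ((∏ j, x j : ℝ) : ℂ) ≠ 0 := by exact_mod_cast hp.ne'
  simp only [cubeIntegrand, partialProdDeficit, logKernel, neg_neg, Real.exp_log hp]
  rw [Complex.cpow_def_of_ne_zero hp', ← Complex.ofReal_log hp.le, Complex.real_smul]
  push_cast
  rw [show -((u - 1) * -(Real.log (∏ j, x j) : ℂ)) = (Real.log (∏ j, x j) : ℂ) * (u - 1) by ring]
  ring

theorem exp_mul_deficitWeight_smul (k : ℕ) (z s u : ℂ) {t : ℝ} (ht : 0 < t) :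
    (Real.exp (-t) * deficitWeight (k + 1) t) • logKernel z s u t
    = (k.factorial : ℂ)⁻¹ * (((t : ℂ) ^ (s + (k + 2 : ℕ) - 1)
        * (Complex.exp (-(u * t)) * deficitRatio t)) / (1 - z * Real.exp (-t))) := by
  have ht' : (t : ℂ) ≠ 0 := by exact_mod_cast ht.ne'
  have hpow : (t : ℂ) ^ (s + (k + 2 : ℕ) - 1) = (t : ℂ) ^ s * (t : ℂ) ^ (k + 1) := by
    rw [show s + ((k + 2 : ℕ) : ℂ) - 1 = s + ((k + 1 : ℕ) : ℂ) by push_cast; ring,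
      Complex.cpow_add _ _ ht', Complex.cpow_natCast]
  have hexp : Complex.exp (-(u * t)) = Complex.exp (-t) * Complex.exp (-((u - 1) * t)) := by
    rw [← Complex.exp_add]; ring_nf
  rw [logKernel, deficitWeight_succ k ht, hpow, hexp, Complex.real_smul]
  push_cast
  ring

theorem integrableOn_cubeIntegrand (k : ℕ) {z s u : ℂ} (hu : 0 < u.re)
    (h : (z ∈ cutPlane ∧ -1 < (s + (k + 2 : ℕ)).re) ∨ (z = 1 ∧ 0 < (s + (k + 2 : ℕ)).re)) :
    IntegrableOn (cubeIntegrand (k + 2) z s u) (Set.Icc 0 1) := by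
  rw [IntegrableOn, restrict_Icc_eq_restrict_openCube]
  refine IntegrableOn.congr_fun ((integrable_openCube_deficit_iff (k + 1)
    (measurable_logKernel z s u)).2 ?_)
    (fun x hx => (cubeIntegrand_eq z s u hx).symm) (measurableSet_openCube _)
  exact IntegrableOn.congr_fun ((integrableOn_deficitIntegral hu h).const_mul (k.factorial : ℂ)⁻¹)
    (fun t ht => (exp_mul_deficitWeight_smul k z s u ht).symm) measurableSet_Ioi

/-- No convergence condition is needed: the change of variables also matches the default value `0`
of divergent integrals. -/
theorem integral_cubeIntegrand (k : ℕ) (z s u : ℂ) :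
    ∫ x in Set.Icc (0 : Fin (k + 2) → ℝ) 1, cubeIntegrand (k + 2) z s u x
      = (k.factorial : ℂ)⁻¹ * deficitIntegral z (s + (k + 2 : ℕ)) u := by
  rw [restrict_Icc_eq_restrict_openCube,
    setIntegral_congr_fun (measurableSet_openCube _) fun x hx => cubeIntegrand_eq z s u hx,
    integral_openCube_deficit (k + 1) (measurable_logKernel z s u), deficitIntegral, ← integral_const_mul]
  exact setIntegral_congr_fun measurableSet_Ioi fun t ht => exp_mul_deficitWeight_smul k z s u ht

/-- Off the cut, divide `deficitIntegral_eq` by `z (σ - 1)`. At `z = 1` the factor `1 - z` removes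
`Φ(1,σ-1,u)` whatever its value, and `-u^{1-σ}/(σ-1)` cancels the pole term in `lerchPhi_one`. -/
theorem closedForm_eq (k : ℕ) {z s u : ℂ} (hu : 0 < u.re)
    (h : (z ∈ cutPlane ∧ -1 < (s + (k + 2 : ℕ)).re) ∨ (z = 1 ∧ 0 < (s + (k + 2 : ℕ)).re))
    (hz : z ≠ 0) (h1 : s + (k + 2 : ℕ) ≠ 1) (h0 : s + (k + 2 : ℕ) ≠ 0) :
    closedForm (k + 2) z s u = (k.factorial : ℂ)⁻¹ * deficitIntegral z (s + (k + 2 : ℕ)) u := by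
  rw [closedForm, Nat.add_sub_cancel,
    show -s - ((k + 2 : ℕ) : ℂ) + 1 = 1 - (s + (k + 2 : ℕ)) by ring]
  set σ : ℂ := s + (k + 2 : ℕ)
  have hσ : σ - 1 ≠ 0 := sub_ne_zero.2 h1
  rcases h with ⟨hzc, hs⟩ | ⟨rfl, hs⟩
  · have key := deficitIntegral_eq hu hs h0 hzc
    have : deficitIntegral z σ u = Complex.Gamma σ * (z * (σ - 1) * lerchPhi z σ u
        + (1 - z) * lerchPhi z (σ - 1) u - u ^ (1 - σ)) / (z * (σ - 1)) := by
      rw [← key]; field_simp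
    rw [this]
    field_simp
    ring
  · have hG := Complex.Gamma_ne_zero_of_re_pos hs
    rw [lerchPhi_one hu hs h1]
    field_simp
    ring

end

/-! ### The theorem and its removable singularities -/

theorem theorem4 (m : ℕ) (hm : 1 < m) (z s u : ℂ) (hu : 0 < u.re)
    (hzs : (z ∈ cutPlane ∧ -(m : ℝ) - 1 < s.re) ∨ (z = 1 ∧ -(m : ℝ) < s.re)) :
    -- the integral converges absolutely
    IntegrableOn (cubeIntegrand m z s u) (Set.Icc 0 1) ∧
    -- the identity, where all terms of the right-hand side are defined
    (z ≠ 0 → s ≠ 1 - m → s ≠ -m →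
      ∫ x in Set.Icc (0 : Fin m → ℝ) 1, cubeIntegrand m z s u x = closedForm m z s u) ∧
    -- the removable singularities of the right-hand side, off the cut
    (z ∈ cutPlane → (z = 0 ∨ s = 1 - m ∨ s = -m) →
      Tendsto (fun p : ℂ × ℂ => closedForm m p.1 p.2 u)
        (𝓝[{p : ℂ × ℂ | p.1 ≠ 0 ∧ p.2 ≠ 1 - m ∧ p.2 ≠ -m}] (z, s))
        (𝓝 (∫ x in Set.Icc (0 : Fin m → ℝ) 1, cubeIntegrand m z s u x))) ∧
    -- the removable singularity of the right-hand side at `z = 1`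
    (z = 1 → s = 1 - m →
      Tendsto (fun w : ℂ => closedForm m 1 w u) (𝓝[≠] s)
        (𝓝 (∫ x in Set.Icc (0 : Fin m → ℝ) 1, cubeIntegrand m z s u x))) := by
  obtain ⟨k, rfl⟩ : ∃ k, m = k + 2 := ⟨m - 2, by omega⟩
  have hre : ∀ w : ℂ, (w + (k + 2 : ℕ)).re = w.re + (k + 2 : ℕ) := fun w => by
    rw [Complex.add_re, Complex.natCast_re]
  have hcond : (z ∈ cutPlane ∧ -1 < (s + (k + 2 : ℕ)).re)
      ∨ (z = 1 ∧ 0 < (s + (k + 2 : ℕ)).re) := by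
    rw [hre]
    exact hzs.imp (fun h => ⟨h.1, by linarith [h.2]⟩) fun h => ⟨h.1, by linarith [h.2]⟩
  have hne1 : ∀ w : ℂ, w ≠ 1 - (k + 2 : ℕ) → w + (k + 2 : ℕ) ≠ 1 := fun w hw h =>
    hw (eq_sub_of_add_eq h)
  have hne0 : ∀ w : ℂ, w ≠ -(k + 2 : ℕ) → w + (k + 2 : ℕ) ≠ 0 := fun w hw h =>
    hw (eq_neg_of_add_eq_zero_left h)
  refine ⟨integrableOn_cubeIntegrand k hu hcond, fun hz h1 h0 => ?_, fun hz _ => ?_, ?_⟩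
  · rw [integral_cubeIntegrand, closedForm_eq k hu hcond hz (hne1 s h1) (hne0 s h0)]
  · have hs : -1 < (s + (k + 2 : ℕ)).re := hcond.elim And.right fun h => by linarith [h.2]
    rw [integral_cubeIntegrand]
    have hc : ContinuousAt (fun p : ℂ × ℂ => (k.factorial : ℂ)⁻¹ *
        deficitIntegral p.1 (p.2 + (k + 2 : ℕ)) u) (z, s) := by
      have hf : ContinuousAt (fun p : ℂ × ℂ => (p.1, p.2 + ((k + 2 : ℕ) : ℂ))) (z, s) := by
        fun_prop
      exact continuousAt_const.mul (ContinuousAt.comp (f := fun p : ℂ × ℂ =>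
        (p.1, p.2 + ((k + 2 : ℕ) : ℂ))) (continuousAt_deficitIntegral hu hs hz) hf)
    -- The continuous half-line integral equals the closed form at all nearby admissible points, so
    -- its value is the limit.
    refine (hc.tendsto.mono_left nhdsWithin_le_nhds).congr' ?_
    have hev : ∀ᶠ p : ℂ × ℂ in 𝓝 (z, s), p.1 ∈ cutPlane ∧ -1 < (p.2 + ((k + 2 : ℕ) : ℂ)).re :=
      ((continuous_fst.tendsto (z, s)).eventually (isOpen_cutPlane.mem_nhds hz)).and
        (ContinuousAt.eventually_mem (f := fun p : ℂ × ℂ => p.2 + ((k + 2 : ℕ) : ℂ)) (x := (z, s))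
          (by fun_prop)
          ((isOpen_re_gt (-1)).mem_nhds hs))
    filter_upwards [nhdsWithin_le_nhds hev, self_mem_nhdsWithin] with p hp hp'
    exact (closedForm_eq k hu (Or.inl hp) hp'.1 (hne1 _ hp'.2.1) (hne0 _ hp'.2.2)).symm
  · rintro rfl hs1
    have hs : 0 < (s + (k + 2 : ℕ)).re := by
      rw [hs1, sub_add_cancel]; simp
    rw [integral_cubeIntegrand]
    have hc : ContinuousAt (fun w : ℂ => (k.factorial : ℂ)⁻¹ *
        deficitIntegral 1 (w + (k + 2 : ℕ)) u) s := by
      exact continuousAt_const.mul (ContinuousAt.comp (f := fun w : ℂ => w + ((k + 2 : ℕ) : ℂ))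
        (continuousAt_deficitIntegral_one hu hs) (by fun_prop))
    refine (hc.tendsto.mono_left nhdsWithin_le_nhds).congr' ?_
    have hev : ∀ᶠ w : ℂ in 𝓝 s, 0 < (w + ((k + 2 : ℕ) : ℂ)).re :=
      ContinuousAt.eventually_mem (f := fun w : ℂ => w + ((k + 2 : ℕ) : ℂ)) (by fun_prop)
        ((isOpen_re_gt 0).mem_nhds hs)
    filter_upwards [nhdsWithin_le_nhds hev, self_mem_nhdsWithin] with w hw hw'
    refine (closedForm_eq k hu (Or.inr ⟨rfl, hw⟩) one_ne_zero (hne1 _ ?_) fun h => ?_).symm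
    · rw [← hs1]; exact hw'
    -- At `z = 1` the case `σ = 0` is already excluded by `Re σ > 0`.
    · rw [h] at hw; simp at hw
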